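/- **Setting.** Let $X$ be a measurable space with base measure $\mu$, $h:X\to[0,\infty)$ and $T:X\to\mathbb R^k$ measurable, $A(\eta)=\log\int_X h(x)e^{\langle T(x),\eta\rangle}\,d\mu(x)\in(-\infty,\infty]$, and suppose the exponential family $p_\eta(x)=h(x)\exp(\langle T(x),\eta\rangle-A(\eta))$ is regular, i.e. $h$ is not $\mu$-a.e. zero and $N=\{\eta\in\mathbb R^k:A(\eta)<\infty\}$ is open and nonempty. Let $A^*(y)=\sup_{\eta}\{\langle y,\eta\rangle-A(\eta)\}$ and $\operatorname{dom}A^*=\{A^*<\infty\}$. Let $x_1,x_2\in X$ with $h(x_i)>0$ and $T(x_i)\in\operatorname{dom}A^*$ (the last condition is automatic when $X$ is finite and $\mu$ is counting measure, e.g. $X=\{0,1\}^I$). Let $p$ be a probability measure (the prior) and $q_1,q_2$ probability densities (the posteriors $q_\phi(\cdot\mid x_1),q_\phi(\cdot\mid x_2)$) on $\mathbb R^d$, and $\beta\ge 0$. Put $\alpha(z)=q_1(z)/(q_1(z)+q_2(z))$ on $\{q_1+q_2>0\}$, $\overline T(z)=\alpha(z)T(x_1)+(1-\alpha(z))T(x_2)$,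 and $$\Delta_{A^*}(x_1,x_2;a)=a\,A^*(T(x_1))+(1-a)\,A^*(T(x_2))-A^*\big(aT(x_1)+(1-a)T(x_2)\big),\qquad a\in[0,1].$$ **Theorem.** 1. The function $(q_1+q_2)\,\Delta_{A^*}(x_1,x_2;\alpha(\cdot))$ is integrable, and, the infimum being over all measurable $\eta:\mathbb R^d\to N$ with decoder $p_\theta(x\mid z)=p_{\eta(z)}(x)$, $$\inf_{\eta(\cdot)}\Big\{\sum_{i=1}^2\mathbb E_{q_i}[-\log p_\theta(x_i\mid z)]+\beta\sum_{i=1}^2\mathrm{KL}(q_i\|p)\Big\}=\mathrm C+\int(q_1+q_2)\,\Delta_{A^*}(x_1,x_2;\alpha(z))\,dz+\beta\sum_{i=1}^2\mathrm{KL}(q_i\|p)$$ in $(-\infty,\infty]$, where $\mathrm C=-\sum_{i=1}^2\big(\log h(x_i)+A^*(T(x_i))\big)$ is independent of $\eta(\cdot)$. The infimum is attained (it is a minimum) if $\overline T(z)\in\operatorname{int}\operatorname{dom}A^*$ for almost every $z$ with $q_1(z)+q_2(z)>0$. 2. $\Delta_{A^*}(x_1,x_2;a)\ge 0$ for all $a\in[0,1]$.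 If $q_1q_2=0$ almost everywhere or $T(x_1)=T(x_2)$, then $\int(q_1+q_2)\Delta_{A^*}(x_1,x_2;\alpha(z))\,dz=0$. Suppose moreover that $N=\mathbb R^k$ (automatic when $X$ is finite and $\mu$ is counting measure) or that $aT(x_1)+(1-a)T(x_2)\in\operatorname{int}\operatorname{dom}A^*$ for some $a\in(0,1)$. Then, for $a\in[0,1]$, $\Delta_{A^*}(x_1,x_2;a)=0$ if and only if $a\in\{0,1\}$ or $T(x_1)=T(x_2)$; and $\int(q_1+q_2)\Delta_{A^*}(x_1,x_2;\alpha(z))\,dz=0$ if and only if $q_1q_2=0$ almost everywhere (disjoint supports) or $T(x_1)=T(x_2)$. 3. Let $C>0$ and suppose $p$ satisfies the Bobkov–Götze/Talagrand inequality $T_1(C)$, either in the form $W_1(\nu,p)\le\sqrt{2C\,\mathrm{KL}(\nu\|p)}$ for every probability measure $\nu$, or in the form $\log\int e^{t(f-\mathbb E_pf)}\,dp\le Ct^2/2$ for every $1$-Lipschitz $f$ and every $t\in\mathbb R$ ($f$ and the exponentials being $p$-integrable). Then $$W_1(q_1,q_2)\le\sqrt{2C\,\mathrm{KL}(q_1\|p)}+\sqrt{2C\,\mathrm{KL}(q_2\|p)},$$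 where $W_1(\mu,\nu)=\inf_\pi\int\|z-z'\|\,d\pi(z,z')$ over couplings $\pi$ of $\mu$ and $\nu$ (Euclidean norm). -/

import Mathlib

open MeasureTheory ProbabilityTheory Set
open scoped ENNReal NNReal

noncomputable section

/-- An exponential family on the sample space `X`, with `k`-dimensional sufficient statistic `T`,
carrier `h` and base measure `base` (counting measure on `{0,1}^I`, Lebesgue measure, ...). -/
structure ExpFamily (X : Type*) [MeasurableSpace X] (k : ℕ) where
  base : Measure X
  h : X → ℝ
  T : X → EuclideanSpace ℝ (Fin k)
  h_nonneg : ∀ x, 0 ≤ h x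
  h_measurable : Measurable h
  T_measurable : Measurable T

namespace ExpFamily

variable {X : Type*} [MeasurableSpace X] {k : ℕ}

/-- The partition function `η ↦ ∫ h(x) exp ⟨T(x), η⟩ dx`, with values in `[0, ∞]`. -/
def partition (F : ExpFamily X k) (η : EuclideanSpace ℝ (Fin k)) : ℝ≥0∞ :=
  ∫⁻ x, ENNReal.ofReal (F.h x * Real.exp (inner ℝ (F.T x) η)) ∂F.base

/-- The log-partition function `A`, with value `+∞` outside the natural parameter space. -/
def A (F : ExpFamily X k) (η : EuclideanSpace ℝ (Fin k)) : EReal :=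
  ENNReal.log (F.partition η)

/-- The natural parameter space `{η | A η < ∞}`. -/
def naturalSpace (F : ExpFamily X k) : Set (EuclideanSpace ℝ (Fin k)) :=
  {η | F.partition η < ∞}

/-- Regular: the natural parameter space is open and nonempty. The first clause excludes the
degenerate case where `h` vanishes almost everywhere, so that no density exists. -/
def IsRegular (F : ExpFamily X k) : Prop :=
  (∀ η, F.partition η ≠ 0) ∧ F.naturalSpace.Nonempty ∧ IsOpen F.naturalSpace

/-- The density `h(x) exp (⟨T(x), η⟩ - A(η))` of the member with natural parameter `η`. -/
def density (F : ExpFamily X k) (η : EuclideanSpace ℝ (Fin k)) (x : X) : ℝ :=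
  F.h x * Real.exp (inner ℝ (F.T x) η - (F.A η).toReal)

end ExpFamily

/-- The convex conjugate `f*(y) = sup_η (⟨y, η⟩ - f(η))` of an extended-real function. -/
def convexConjugate {k : ℕ} (f : EuclideanSpace ℝ (Fin k) → EReal)
    (y : EuclideanSpace ℝ (Fin k)) : EReal :=
  ⨆ η, (((inner ℝ y η : ℝ) : EReal) - f η)

/-- The effective domain `{y | f y < ∞}`. -/
def effectiveDomain {k : ℕ} (f : EuclideanSpace ℝ (Fin k) → EReal) :
    Set (EuclideanSpace ℝ (Fin k)) :=
  {y | f y < ⊤}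

/-- The Jensen gap `a f(y₁) + (1 - a) f(y₂) - f(a y₁ + (1 - a) y₂)`; it is used for functions
`f` that are finite at the three points. -/
def jensenGap {k : ℕ} (f : EuclideanSpace ℝ (Fin k) → EReal)
    (y₁ y₂ : EuclideanSpace ℝ (Fin k)) (a : ℝ) : ℝ :=
  a * (f y₁).toReal + (1 - a) * (f y₂).toReal - (f (a • y₁ + (1 - a) • y₂)).toReal

/-- `q` is a probability density on `ℝ^d` with respect to Lebesgue measure. -/
def IsProbDensity {d : ℕ} (q : EuclideanSpace ℝ (Fin d) → ℝ) : Prop :=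
  Measurable q ∧ (∀ z, 0 ≤ q z) ∧ ∫⁻ z, ENNReal.ofReal (q z) = 1

/-- The measure on `ℝ^d` with density `q`. -/
def densityMeasure {d : ℕ} (q : EuclideanSpace ℝ (Fin d) → ℝ) :
    Measure (EuclideanSpace ℝ (Fin d)) :=
  volume.withDensity (fun z => ENNReal.ofReal (q z))

/-- The expectation of `f` as an extended real, `∫ f⁺ dμ - ∫ f⁻ dμ`; it is used only for functions
that are bounded below, and is `+∞` exactly when the expectation diverges. -/
def extExpectation {Z : Type*} [MeasurableSpace Z] (μ : Measure Z) (f : Z → ℝ) : EReal :=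
  ((∫⁻ z, ENNReal.ofReal (f z) ∂μ : ℝ≥0∞) : EReal)
    - ((∫⁻ z, ENNReal.ofReal (-f z) ∂μ : ℝ≥0∞) : EReal)

/-- The measurable natural-parameter maps `η(·)` from the latent space. -/
def admissibleMaps {X : Type*} [MeasurableSpace X] {k : ℕ} (F : ExpFamily X k) (d : ℕ) :
    Set (EuclideanSpace ℝ (Fin d) → EuclideanSpace ℝ (Fin k)) :=
  {η | Measurable η ∧ ∀ z, η z ∈ F.naturalSpace}

/-- The regularizer `β ∑ᵢ KL(qᵢ ‖ p)`. -/
def klTerm {d : ℕ} (p : Measure (EuclideanSpace ℝ (Fin d)))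
    (q₁ q₂ : EuclideanSpace ℝ (Fin d) → ℝ) (β : ℝ) : EReal :=
  (β : EReal) * ((InformationTheory.klDiv (densityMeasure q₁) p
    + InformationTheory.klDiv (densityMeasure q₂) p : ℝ≥0∞) : EReal)

/-- The two-user objective
`∑ᵢ E_{qᵢ}[-log p(xᵢ | z)] + β ∑ᵢ KL(qᵢ ‖ p)` as a function of the map `η(·)`, where
`p(x | z)` is the member of the family with natural parameter `η(z)`. -/
def twoUserObjective {X : Type*} [MeasurableSpace X] {k d : ℕ} (F : ExpFamily X k) (x₁ x₂ : X)
    (p : Measure (EuclideanSpace ℝ (Fin d))) (q₁ q₂ : EuclideanSpace ℝ (Fin d) → ℝ) (β : ℝ)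
    (η : EuclideanSpace ℝ (Fin d) → EuclideanSpace ℝ (Fin k)) : EReal :=
  extExpectation (densityMeasure q₁) (fun z => -Real.log (F.density (η z) x₁))
    + extExpectation (densityMeasure q₂) (fun z => -Real.log (F.density (η z) x₂))
    + klTerm p q₁ q₂ β

/-- The posterior ratio `α = q₁ / (q₁ + q₂)` (with value `0` where `q₁ + q₂ = 0`). -/
def posteriorRatio {d : ℕ} (q₁ q₂ : EuclideanSpace ℝ (Fin d) → ℝ)
    (z : EuclideanSpace ℝ (Fin d)) : ℝ :=
  q₁ z / (q₁ z + q₂ z)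

/-- The 1-Wasserstein distance, as an infimum over couplings. -/
def wasserstein1 {d : ℕ} (μ ν : Measure (EuclideanSpace ℝ (Fin d))) : ℝ≥0∞ :=
  ⨅ (π : Measure (EuclideanSpace ℝ (Fin d) × EuclideanSpace ℝ (Fin d)))
    (_ : π.map Prod.fst = μ ∧ π.map Prod.snd = ν), ∫⁻ w, edist w.1 w.2 ∂π

/-- The transport-entropy inequality `T₁(C)`:
`W₁(ν, p) ≤ √(2 C KL(ν ‖ p))` for every probability measure `ν`. -/
def SatisfiesT1 {d : ℕ} (p : Measure (EuclideanSpace ℝ (Fin d))) (C : ℝ) : Prop :=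
  ∀ ν : Measure (EuclideanSpace ℝ (Fin d)), IsProbabilityMeasure ν →
    wasserstein1 ν p ≤ (ENNReal.ofReal (2 * C) * InformationTheory.klDiv ν p) ^ (1 / 2 : ℝ)

/-- The sub-Gaussian moment generating function bound for Lipschitz functions, i.e. `T₁(C)` in its
exponential-integrability form: `log ∫ exp (t (f - E_p f)) dp ≤ C t² / 2` for every 1-Lipschitz
`f` and every real `t`. -/
def SatisfiesLipschitzMGF {d : ℕ} (p : Measure (EuclideanSpace ℝ (Fin d))) (C : ℝ) : Prop :=
  ∀ f : EuclideanSpace ℝ (Fin d) → ℝ, LipschitzWith 1 f → Integrable f p ∧ ∀ t : ℝ,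
    Integrable (fun z => Real.exp (t * (f z - ∫ w, f w ∂p))) p ∧
    Real.log (∫ z, Real.exp (t * (f z - ∫ w, f w ∂p)) ∂p) ≤ C * t ^ 2 / 2

end

/-!
The argument rests on the Fenchel–Young gap `gap y η = A*(y) - ⟨y, η⟩ + A(η)`, which is nonnegative
for `y ∈ dom A*` and natural `η`, and which has infimum zero over `η`.

*The value of the problem.* Up to constants, `-log p_η(xᵢ)` is `gap (T xᵢ) η`. Averaging the two
gaps with the weights `α` and `1 - α` gives the Jensen gap of `A*` plus the gap at the mixed
statistic (`gap_mix`), so the objective is the claimed value plus the integral of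
`(q₁ + q₂) gap (mixedT z) (η z)` (`twoUserObjective_eq`). This excess is made small by a measurable
near-maximiser, chosen from a sequence along which the graph of `A` is approximated
(`exists_measurable_gap_lt`). At an interior point of `dom A*` the gap is coercive and lower
semicontinuous, and its minimiser is unique, because two minimisers force `dom A*` into a
hyperplane. Hence near-maximisers converge to the maximiser, which is therefore measurable
(`exists_measurable_gap_eq_zero`).

*Equality in Jensen's inequality.* If the Jensen gap vanishes at an interior weight, every
maximising sequence for the mixture is maximising for both endpoints. If the supremum is attained,
differentiability of the moment generating function identifies the two endpoints
(`eq_of_gap_eq_zero_left`). This settles the case of an interior mixture. When every parameter is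
natural the supremum need not be attained. Then the square roots of the densities along a maximising
sequence are Cauchy in `L²`, because the Hellinger distance is controlled by the gaps
(`integral_sqrtDensity_sub_sq_le`). Their limit is again an exponential density, restricted to a
measurable set, since affine functions of `T` form a finite-dimensional and hence closed space
(`exists_ae_tendsto_sqrtDensity`). The variational inequalities pass to the limit
(`exp_inner_le_integral_limit`) and show that the limiting density has both endpoints as its mean
(`eq_of_jensenGap_eq_zero_of_univ`).

*The transport bound.* Under the transport inequality it is the triangle inequality for `W₁`, proved
by gluing couplings (`wasserstein1_triangle`). Under the moment generating function bound, the Gibbs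
variational inequality bounds `∫ f dq - ∫ f dp` for `1`-Lipschitz `f`
(`SatisfiesLipschitzMGF.integral_sub_le`). Kantorovich–Rubinstein duality
(`wasserstein1_le_of_lipschitz`) turns this into a bound on `W₁`. The duality is reduced to finitely
many points by a simple function, and there it follows from the separation of a compact convex set
from a closed one (`exists_transport_plan`).
-/

noncomputable section

/-! ### Exponential families and their carrier measure -/

namespace ExpFamily

variable {X : Type*} [MeasurableSpace X] {k : ℕ}

/-- The carrier measure `h · base`, with respect to which the members of the family have the
densities `exp (⟨T, η⟩ - A η)`. -/
def carrier (F : ExpFamily X k) : Measure X :=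
  F.base.withDensity fun x => ENNReal.ofReal (F.h x)

/-- The log-partition function as a real number; meaningful on the natural parameter space. -/
def logZ (F : ExpFamily X k) (η : EuclideanSpace ℝ (Fin k)) : ℝ := (F.A η).toReal

/-- The conjugate `A*` as a real number; meaningful on its effective domain. -/
def conj (F : ExpFamily X k) (y : EuclideanSpace ℝ (Fin k)) : ℝ :=
  (convexConjugate F.A y).toReal

/-- The effective domain of `A*`. -/
def conjDom (F : ExpFamily X k) : Set (EuclideanSpace ℝ (Fin k)) :=
  effectiveDomain (convexConjugate F.A)

/-- The Fenchel–Young gap `A*(y) - ⟨y, η⟩ + A(η)`. -/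
def gap (F : ExpFamily X k) (y η : EuclideanSpace ℝ (Fin k)) : ℝ :=
  F.conj y - inner ℝ y η + F.logZ η

variable {F : ExpFamily X k}

lemma measurable_inner_T (F : ExpFamily X k) (η : EuclideanSpace ℝ (Fin k)) :
    Measurable fun x => inner ℝ (F.T x) η :=
  F.T_measurable.inner measurable_const

lemma partition_eq (F : ExpFamily X k) (η : EuclideanSpace ℝ (Fin k)) :
    F.partition η = ∫⁻ x, ENNReal.ofReal (Real.exp (inner ℝ (F.T x) η)) ∂F.carrier := by
  rw [carrier, lintegral_withDensity_eq_lintegral_mul _ F.h_measurable.ennreal_ofReal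
    (F.measurable_inner_T η).exp.ennreal_ofReal]
  simp only [partition, Pi.mul_apply, ENNReal.ofReal_mul (F.h_nonneg _)]

lemma partition_eq_exp (hF : F.IsRegular) {η : EuclideanSpace ℝ (Fin k)}
    (hη : η ∈ F.naturalSpace) : F.partition η = ENNReal.ofReal (Real.exp (F.logZ η)) := by
  rw [logZ, A, ENNReal.log_pos_real (hF.1 η) (ne_of_lt hη), EReal.toReal_coe,
    Real.exp_log (ENNReal.toReal_pos (hF.1 η) (ne_of_lt hη)), ENNReal.ofReal_toReal (ne_of_lt hη)]

lemma A_eq_coe (hF : F.IsRegular) {η : EuclideanSpace ℝ (Fin k)}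
    (hη : η ∈ F.naturalSpace) : F.A η = (F.logZ η : EReal) := by
  rw [logZ, A, ENNReal.log_pos_real (hF.1 η) (ne_of_lt hη), EReal.toReal_coe]

lemma A_eq_top {η : EuclideanSpace ℝ (Fin k)} (hη : η ∉ F.naturalSpace) : F.A η = ⊤ := by
  have : F.partition η = ⊤ := by simpa [naturalSpace] using hη
  rw [A, this, ENNReal.log_top]

lemma mem_naturalSpace_of_le {η : EuclideanSpace ℝ (Fin k)} {c : ℝ}
    (h : F.partition η ≤ ENNReal.ofReal (Real.exp c)) : η ∈ F.naturalSpace :=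
  h.trans_lt ENNReal.ofReal_lt_top

lemma logZ_le_of_partition_le (hF : F.IsRegular) {η : EuclideanSpace ℝ (Fin k)} {c : ℝ}
    (h : F.partition η ≤ ENNReal.ofReal (Real.exp c)) : F.logZ η ≤ c := by
  rw [partition_eq_exp hF (mem_naturalSpace_of_le h),
    ENNReal.ofReal_le_ofReal_iff (Real.exp_nonneg _)] at h
  exact Real.exp_le_exp.1 h

lemma integrable_exp {η : EuclideanSpace ℝ (Fin k)} (hη : η ∈ F.naturalSpace) :
    Integrable (fun x => Real.exp (inner ℝ (F.T x) η)) F.carrier := by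
  refine ⟨(F.measurable_inner_T η).exp.aestronglyMeasurable, ?_⟩
  rw [hasFiniteIntegral_iff_ofReal (.of_forall fun x => Real.exp_nonneg _), ← partition_eq]
  exact hη

lemma mem_naturalSpace_of_integrable {η : EuclideanSpace ℝ (Fin k)}
    (h : Integrable (fun x => Real.exp (inner ℝ (F.T x) η)) F.carrier) : η ∈ F.naturalSpace := by
  have h' := h.2
  rwa [hasFiniteIntegral_iff_ofReal (.of_forall fun x => Real.exp_nonneg _),
    ← partition_eq] at h'

lemma integral_exp (hF : F.IsRegular) {η : EuclideanSpace ℝ (Fin k)} (hη : η ∈ F.naturalSpace) :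
    ∫ x, Real.exp (inner ℝ (F.T x) η) ∂F.carrier = Real.exp (F.logZ η) := by
  rw [integral_eq_lintegral_of_nonneg_ae (.of_forall fun x => Real.exp_nonneg _)
    (F.measurable_inner_T η).exp.aestronglyMeasurable, ← partition_eq, partition_eq_exp hF hη,
    ENNReal.toReal_ofReal (Real.exp_nonneg _)]

/-! ### The conjugate on its effective domain -/

lemma coe_inner_sub_A_le (y η : EuclideanSpace ℝ (Fin k)) :
    ((inner ℝ y η : ℝ) : EReal) - F.A η ≤ convexConjugate F.A y :=
  le_iSup (fun η => ((inner ℝ y η : ℝ) : EReal) - F.A η) η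

lemma convexConjugate_ne_bot (hF : F.IsRegular) (y : EuclideanSpace ℝ (Fin k)) :
    convexConjugate F.A y ≠ ⊥ := by
  obtain ⟨η, hη⟩ := hF.2.1
  refine ne_bot_of_le_ne_bot ?_ (coe_inner_sub_A_le y η)
  rw [A_eq_coe hF hη, ← EReal.coe_sub]
  exact EReal.coe_ne_bot _

lemma convexConjugate_eq_coe (hF : F.IsRegular) {y : EuclideanSpace ℝ (Fin k)}
    (hy : y ∈ F.conjDom) : convexConjugate F.A y = (F.conj y : EReal) :=
  (EReal.coe_toReal (ne_of_lt hy) (convexConjugate_ne_bot hF y)).symm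

lemma gap_nonneg (hF : F.IsRegular) {y η : EuclideanSpace ℝ (Fin k)}
    (hy : y ∈ F.conjDom) (hη : η ∈ F.naturalSpace) : 0 ≤ F.gap y η := by
  have h := coe_inner_sub_A_le (F := F) y η
  rw [convexConjugate_eq_coe hF hy, A_eq_coe hF hη, ← EReal.coe_sub, EReal.coe_le_coe_iff] at h
  rw [gap]; linarith

lemma convexConjugate_le (hF : F.IsRegular) {y : EuclideanSpace ℝ (Fin k)} {c : ℝ}
    (h : ∀ η ∈ F.naturalSpace, inner ℝ y η - F.logZ η ≤ c) : convexConjugate F.A y ≤ c := by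
  refine iSup_le fun η => ?_
  by_cases hη : η ∈ F.naturalSpace
  · rw [A_eq_coe hF hη, ← EReal.coe_sub]
    exact EReal.coe_le_coe_iff.2 (h η hη)
  · rw [A_eq_top hη, EReal.sub_top]
    exact bot_le

lemma mem_conjDom (hF : F.IsRegular) {y : EuclideanSpace ℝ (Fin k)} {c : ℝ}
    (h : ∀ η ∈ F.naturalSpace, inner ℝ y η - F.logZ η ≤ c) : y ∈ F.conjDom :=
  (convexConjugate_le hF h).trans_lt (EReal.coe_lt_top c)

lemma conj_le (hF : F.IsRegular) {y : EuclideanSpace ℝ (Fin k)} {c : ℝ}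
    (h : ∀ η ∈ F.naturalSpace, inner ℝ y η - F.logZ η ≤ c) : F.conj y ≤ c := by
  have := convexConjugate_le hF h
  rwa [convexConjugate_eq_coe hF (mem_conjDom hF h), EReal.coe_le_coe_iff] at this

lemma exists_gap_lt (hF : F.IsRegular) {y : EuclideanSpace ℝ (Fin k)}
    {ε : ℝ} (hε : 0 < ε) : ∃ η ∈ F.naturalSpace, F.gap y η < ε := by
  by_contra! h
  have := conj_le hF (y := y) (c := F.conj y - ε) fun η hη => by
    have := h η hη
    rw [gap] at this; linarith
  linarith

lemma convexOn_conj (hF : F.IsRegular) : ConvexOn ℝ F.conjDom F.conj := by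
  have key : ∀ ⦃x⦄, x ∈ F.conjDom → ∀ ⦃y⦄, y ∈ F.conjDom → ∀ ⦃a b : ℝ⦄, 0 ≤ a → 0 ≤ b →
      a + b = 1 → ∀ η ∈ F.naturalSpace, inner ℝ (a • x + b • y) η - F.logZ η
        ≤ a • F.conj x + b • F.conj y := by
    intro x hx y hy a b ha hb hab η hη
    have h1 := mul_nonneg ha (gap_nonneg hF hx hη)
    have h2 := mul_nonneg hb (gap_nonneg hF hy hη)
    have h3 : F.logZ η = a * F.logZ η + b * F.logZ η := by rw [← add_mul, hab, one_mul]
    simp only [gap] at h1 h2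
    rw [inner_add_left, real_inner_smul_left, real_inner_smul_left, smul_eq_mul, smul_eq_mul, h3]
    linarith
  exact ⟨fun x hx y hy a b ha hb hab => mem_conjDom hF (key hx hy ha hb hab),
    fun x hx y hy a b ha hb hab => conj_le hF (key hx hy ha hb hab)⟩

/-- The Fenchel–Young gap at a mixture splits into the mixed gaps minus the Jensen gap. -/
lemma gap_mix (y₁ y₂ η : EuclideanSpace ℝ (Fin k)) (a : ℝ) :
    a * F.gap y₁ η + (1 - a) * F.gap y₂ η
      = jensenGap (convexConjugate F.A) y₁ y₂ a + F.gap (a • y₁ + (1 - a) • y₂) η := by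
  simp only [gap, jensenGap, conj, inner_add_left, real_inner_smul_left]
  ring

/-! ### Semicontinuity and measurability -/

/-- Fatou's lemma for the partition function along a sequence. -/
lemma partition_le_of_tendsto {η : ℕ → EuclideanSpace ℝ (Fin k)} {x : EuclideanSpace ℝ (Fin k)}
    (h : Filter.Tendsto η Filter.atTop (nhds x)) {c : ℕ → ℝ≥0∞} {c₀ : ℝ≥0∞}
    (hc : ∀ n, F.partition (η n) ≤ c n) (hc' : Filter.Tendsto c Filter.atTop (nhds c₀)) :
    F.partition x ≤ c₀ := by
  rw [partition_eq]
  calc ∫⁻ w, ENNReal.ofReal (Real.exp (inner ℝ (F.T w) x)) ∂F.carrier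
      = ∫⁻ w, Filter.liminf (fun n => ENNReal.ofReal (Real.exp (inner ℝ (F.T w) (η n))))
          Filter.atTop ∂F.carrier := by
        refine lintegral_congr fun w => (Filter.Tendsto.liminf_eq ?_).symm
        refine ENNReal.tendsto_ofReal ((Real.continuous_exp.tendsto _).comp ?_)
        exact tendsto_const_nhds.inner h
    _ ≤ Filter.liminf (fun n => F.partition (η n)) Filter.atTop := by
        simp only [partition_eq]
        exact lintegral_liminf_le fun n => (F.measurable_inner_T _).exp.ennreal_ofReal
    _ ≤ Filter.liminf c Filter.atTop := Filter.liminf_le_liminf (.of_forall hc)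
    _ = c₀ := hc'.liminf_eq

lemma measurable_partition (F : ExpFamily X k) : Measurable F.partition := by
  refine measurable_of_Iic fun c => IsClosed.measurableSet ?_
  refine IsSeqClosed.isClosed fun η x hη hx => ?_
  exact partition_le_of_tendsto hx hη tendsto_const_nhds

lemma measurable_logZ (F : ExpFamily X k) : Measurable F.logZ :=
  (ENNReal.continuous_log.measurable.comp F.measurable_partition).ereal_toReal

lemma measurable_conj (F : ExpFamily X k) : Measurable F.conj := by
  refine Measurable.ereal_toReal (LowerSemicontinuous.measurable ?_)
  refine lowerSemicontinuous_iSup fun η => Continuous.lowerSemicontinuous ?_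
  rcases eq_or_ne (F.A η) ⊤ with h | h
  · simp only [h, EReal.sub_top]
    exact continuous_const
  rcases eq_or_ne (F.A η) ⊥ with h' | h'
  · simp only [h', EReal.coe_sub_bot]
    exact continuous_const
  · rw [← EReal.coe_toReal h h']
    simp only [← EReal.coe_sub]
    exact continuous_coe_real_ereal.comp (by fun_prop)

lemma measurable_gap {Z : Type*} [MeasurableSpace Z] {Y η : Z → EuclideanSpace ℝ (Fin k)}
    (hY : Measurable Y) (hη : Measurable η) : Measurable fun z => F.gap (Y z) (η z) :=
  ((F.measurable_conj.comp hY).sub (hY.inner hη)).add (F.measurable_logZ.comp hη)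

/-- A sequence in the natural parameter space along which every point of the graph of `A` is
approximated. It comes from the separability of the graph, so no continuity of `A` is involved. -/
lemma exists_seq_graph_dense (hF : F.IsRegular) : ∃ e : ℕ → EuclideanSpace ℝ (Fin k),
    (∀ n, e n ∈ F.naturalSpace) ∧ ∀ η ∈ F.naturalSpace, ∀ y : EuclideanSpace ℝ (Fin k), ∀ ε > 0,
      ∃ n, F.gap y (e n) < F.gap y η + ε := by
  let G : Set (EuclideanSpace ℝ (Fin k) × ℝ) := (fun η => (η, F.logZ η)) '' F.naturalSpace
  have : Nonempty G := (hF.2.1.image _).to_subtype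
  let s := TopologicalSpace.denseSeq G
  refine ⟨fun n => (s n : EuclideanSpace ℝ (Fin k) × ℝ).1, fun n => ?_, fun η hη y ε hε => ?_⟩
  · obtain ⟨η, hη, h⟩ := (s n).2
    change (s n : EuclideanSpace ℝ (Fin k) × ℝ).1 ∈ _
    rw [← h]; exact hη
  · let φ : G → ℝ := fun g => F.conj y - inner ℝ y (g : EuclideanSpace ℝ (Fin k) × ℝ).1
      + (g : EuclideanSpace ℝ (Fin k) × ℝ).2
    have hφ : Continuous φ := by fun_prop
    let g₀ : G := ⟨(η, F.logZ η), mem_image_of_mem _ hη⟩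
    have hopen : IsOpen {g | φ g < φ g₀ + ε} := isOpen_lt hφ continuous_const
    obtain ⟨n, hn⟩ := (TopologicalSpace.denseRange_denseSeq G).exists_mem_open hopen
      ⟨g₀, by simpa using hε⟩
    refine ⟨n, ?_⟩
    obtain ⟨η', hη', h⟩ := (s n).2
    have h2 : F.logZ (s n : EuclideanSpace ℝ (Fin k) × ℝ).1
        = (s n : EuclideanSpace ℝ (Fin k) × ℝ).2 := by rw [← h]
    rw [gap, h2]
    exact hn

/-- Measurable selection of parameters that nearly attain the supremum defining `A*`. -/
lemma exists_measurable_gap_lt (hF : F.IsRegular) {Z : Type*} [MeasurableSpace Z]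
    {Y : Z → EuclideanSpace ℝ (Fin k)} (hY : Measurable Y) {ε : ℝ} (hε : 0 < ε) :
    ∃ η : Z → EuclideanSpace ℝ (Fin k), Measurable η ∧ ∀ z, η z ∈ F.naturalSpace ∧
      F.gap (Y z) (η z) < ε := by
  classical
  obtain ⟨e, he, hd⟩ := exists_seq_graph_dense hF
  have hex : ∀ z, ∃ n, F.gap (Y z) (e n) < ε := fun z => by
    obtain ⟨η, hη, h⟩ := exists_gap_lt hF (y := Y z) (half_pos hε)
    obtain ⟨n, hn⟩ := hd η hη (Y z) (ε / 2) (half_pos hε)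
    exact ⟨n, by linarith⟩
  refine ⟨fun z => e (Nat.find (hex z)), ?_, fun z => ⟨he _, Nat.find_spec (hex z)⟩⟩
  refine (measurable_from_nat (f := e)).comp (measurable_find hex fun n => ?_)
  exact measurableSet_lt (measurable_gap hY measurable_const) measurable_const

/-! ### Minimisers of the Fenchel–Young gap at interior points -/

/-- At an interior point of `dom A*` the gap is coercive: `A*` is bounded near `y`, and the gap is
nonnegative at `y + r η / ‖η‖`. -/
lemma exists_norm_le_gap (hF : F.IsRegular) {y : EuclideanSpace ℝ (Fin k)}
    (hy : y ∈ interior F.conjDom) :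
    ∃ r > 0, ∀ η ∈ F.naturalSpace, r * ‖η‖ ≤ F.gap y η + 1 := by
  have hcont : ContinuousAt F.conj y :=
    ((convexOn_conj hF).continuousOn_interior).continuousAt (isOpen_interior.mem_nhds hy)
  have h1 : ∀ᶠ w in nhds y, F.conj w < F.conj y + 1 ∧ w ∈ F.conjDom :=
    (hcont.eventually_lt continuousAt_const (by simp)).and (mem_interior_iff_mem_nhds.1 hy)
  obtain ⟨δ, hδ, hball⟩ := Metric.eventually_nhds_iff.1 h1
  refine ⟨δ / 2, by positivity, fun η hη => ?_⟩
  rcases eq_or_ne η 0 with rfl | hne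
  · have := gap_nonneg hF (interior_subset hy) hη
    simp; linarith
  have hpos : 0 < ‖η‖ := norm_pos_iff.2 hne
  obtain ⟨hlt, hdom⟩ := hball (y := y + (δ / 2 / ‖η‖) • η) (by
    rw [dist_self_add_left, norm_smul, Real.norm_of_nonneg (by positivity),
      div_mul_cancel₀ _ hpos.ne']
    linarith)
  have h2 := gap_nonneg hF hdom hη
  rw [gap, inner_add_left, real_inner_smul_left, real_inner_self_eq_norm_sq] at h2
  have h3 : δ / 2 / ‖η‖ * ‖η‖ ^ 2 = δ / 2 * ‖η‖ := by field_simp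
  rw [gap]; linarith

/-- Lower semicontinuity of the gap in the parameter; the limit of near-minimisers does not leave
the natural parameter space. -/
lemma gap_eq_zero_of_tendsto (hF : F.IsRegular) {y : EuclideanSpace ℝ (Fin k)}
    (hy : y ∈ F.conjDom) {η : ℕ → EuclideanSpace ℝ (Fin k)} {x : EuclideanSpace ℝ (Fin k)}
    (hη : ∀ n, η n ∈ F.naturalSpace)
    (hgap : Filter.Tendsto (fun n => F.gap y (η n)) Filter.atTop (nhds 0))
    (hx : Filter.Tendsto η Filter.atTop (nhds x)) : x ∈ F.naturalSpace ∧ F.gap y x = 0 := by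
  have hle : F.partition x ≤ ENNReal.ofReal (Real.exp (0 - F.conj y + inner ℝ y x)) := by
    refine partition_le_of_tendsto hx
      (c := fun n => ENNReal.ofReal (Real.exp (F.gap y (η n) - F.conj y + inner ℝ y (η n))))
      (fun n => ?_) ?_
    · rw [partition_eq_exp hF (hη n), gap]
      exact le_of_eq (by congr 2; ring)
    · refine ENNReal.tendsto_ofReal ((Real.continuous_exp.tendsto _).comp ?_)
      exact (hgap.sub_const _).add (tendsto_const_nhds.inner hx)
  have hxN := mem_naturalSpace_of_le hle
  refine ⟨hxN, le_antisymm ?_ (gap_nonneg hF hy hxN)⟩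
  have := logZ_le_of_partition_le hF hle
  rw [gap]; linarith

/-- The square root of the density, relative to the carrier measure, of the member of the family
with natural parameter `η`. -/
def sqrtDensity (F : ExpFamily X k) (η : EuclideanSpace ℝ (Fin k)) (x : X) : ℝ :=
  Real.exp ((inner ℝ (F.T x) η - F.logZ η) / 2)

lemma measurable_sqrtDensity (F : ExpFamily X k) (η : EuclideanSpace ℝ (Fin k)) :
    Measurable (F.sqrtDensity η) :=
  (((F.measurable_inner_T η).sub_const _).div_const _).exp

lemma sqrtDensity_pos (η : EuclideanSpace ℝ (Fin k)) (x : X) : 0 < F.sqrtDensity η x :=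
  Real.exp_pos _

lemma sqrtDensity_sq (η : EuclideanSpace ℝ (Fin k)) (x : X) :
    F.sqrtDensity η x ^ 2 = Real.exp (inner ℝ (F.T x) η) * Real.exp (-F.logZ η) := by
  rw [sqrtDensity, ← Real.exp_nat_mul, ← Real.exp_add]; congr 1; push_cast; ring

lemma integrable_sqrtDensity_sq {η : EuclideanSpace ℝ (Fin k)} (hη : η ∈ F.naturalSpace) :
    Integrable (fun x => F.sqrtDensity η x ^ 2) F.carrier := by
  simp only [sqrtDensity_sq]; exact (integrable_exp hη).mul_const _

lemma integral_sqrtDensity_sq (hF : F.IsRegular) {η : EuclideanSpace ℝ (Fin k)}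
    (hη : η ∈ F.naturalSpace) : ∫ x, F.sqrtDensity η x ^ 2 ∂F.carrier = 1 := by
  simp only [sqrtDensity_sq]
  rw [integral_mul_const, integral_exp hF hη, ← Real.exp_add, add_neg_cancel, Real.exp_zero]

lemma integrable_sqrtDensity_mul {η₁ η₂ : EuclideanSpace ℝ (Fin k)} (h₁ : η₁ ∈ F.naturalSpace)
    (h₂ : η₂ ∈ F.naturalSpace) :
    Integrable (fun x => F.sqrtDensity η₁ x * F.sqrtDensity η₂ x) F.carrier := by
  refine ((integrable_sqrtDensity_sq h₁).add (integrable_sqrtDensity_sq h₂)).mono'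
    ((F.measurable_sqrtDensity η₁).mul (F.measurable_sqrtDensity η₂)).aestronglyMeasurable
    (.of_forall fun x => ?_)
  rw [Real.norm_of_nonneg (mul_pos (sqrtDensity_pos _ _) (sqrtDensity_pos _ _)).le, Pi.add_apply]
  nlinarith [sq_nonneg (F.sqrtDensity η₁ x - F.sqrtDensity η₂ x), sq_nonneg (F.sqrtDensity η₁ x),
    sq_nonneg (F.sqrtDensity η₂ x)]

lemma integrable_sqrtDensity_sub_sq {η₁ η₂ : EuclideanSpace ℝ (Fin k)}
    (h₁ : η₁ ∈ F.naturalSpace) (h₂ : η₂ ∈ F.naturalSpace) :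
    Integrable (fun x => (F.sqrtDensity η₁ x - F.sqrtDensity η₂ x) ^ 2) F.carrier := by
  simp only [sub_sq, mul_assoc]
  exact ((integrable_sqrtDensity_sq h₁).sub ((integrable_sqrtDensity_mul h₁ h₂).const_mul 2)).add
    (integrable_sqrtDensity_sq h₂)

/-- The squared Hellinger distance of two members of the family is controlled by their
Fenchel–Young gaps at a common point: the Hellinger affinity is
`exp (A ((η₁ + η₂) / 2) - (A η₁ + A η₂) / 2)`, and the gap at the midpoint is nonnegative. -/
lemma integral_sqrtDensity_sub_sq_le (hF : F.IsRegular) {y η₁ η₂ : EuclideanSpace ℝ (Fin k)}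
    (hy : y ∈ F.conjDom) (h₁ : η₁ ∈ F.naturalSpace) (h₂ : η₂ ∈ F.naturalSpace) :
    ∫ x, (F.sqrtDensity η₁ x - F.sqrtDensity η₂ x) ^ 2 ∂F.carrier ≤ F.gap y η₁ + F.gap y η₂ := by
  set m : EuclideanSpace ℝ (Fin k) := (1 / 2 : ℝ) • (η₁ + η₂) with hm
  set c : ℝ := (F.logZ η₁ + F.logZ η₂) / 2 with hc
  have hprod : ∀ x, F.sqrtDensity η₁ x * F.sqrtDensity η₂ x
      = Real.exp (inner ℝ (F.T x) m) * Real.exp (-c) := fun x => by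
    simp only [sqrtDensity, hm, hc]
    rw [← Real.exp_add, ← Real.exp_add, real_inner_smul_right, inner_add_right]; congr 1; ring
  have hi1 := integrable_sqrtDensity_sq h₁
  have hi2 := integrable_sqrtDensity_sq h₂
  have hi12 := integrable_sqrtDensity_mul h₁ h₂
  have hmN : m ∈ F.naturalSpace := by
    refine mem_naturalSpace_of_integrable ((hi12.mul_const (Real.exp c)).congr ?_)
    refine .of_forall fun x => ?_
    simp only
    rw [hprod, mul_assoc, ← Real.exp_add, neg_add_cancel, Real.exp_zero, mul_one]
  have hge : 1 - (F.gap y η₁ + F.gap y η₂) / 2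
      ≤ ∫ x, F.sqrtDensity η₁ x * F.sqrtDensity η₂ x ∂F.carrier := by
    simp only [hprod]
    rw [integral_mul_const, integral_exp hF hmN, ← Real.exp_add]
    have h := gap_nonneg hF hy hmN
    have h' := Real.add_one_le_exp (F.logZ m + -c)
    simp only [gap, hm, real_inner_smul_right, inner_add_right] at h h' ⊢
    linarith
  have hsub : ∀ x, (F.sqrtDensity η₁ x - F.sqrtDensity η₂ x) ^ 2 = F.sqrtDensity η₁ x ^ 2
      + F.sqrtDensity η₂ x ^ 2 - 2 * (F.sqrtDensity η₁ x * F.sqrtDensity η₂ x) := fun x => by ring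
  have hadd : Integrable (fun x => F.sqrtDensity η₁ x ^ 2 + F.sqrtDensity η₂ x ^ 2) F.carrier :=
    hi1.add hi2
  simp only [hsub]
  rw [integral_sub hadd (hi12.const_mul 2), integral_add hi1 hi2, integral_const_mul,
    integral_sqrtDensity_sq hF h₁, integral_sqrtDensity_sq hF h₂]
  linarith

lemma inner_ae_eq_of_gap_eq_zero (hF : F.IsRegular) {y η₁ η₂ : EuclideanSpace ℝ (Fin k)}
    (hy : y ∈ F.conjDom) (h₁ : η₁ ∈ F.naturalSpace) (h₂ : η₂ ∈ F.naturalSpace)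
    (hg₁ : F.gap y η₁ = 0) (hg₂ : F.gap y η₂ = 0) :
    ∀ᵐ x ∂F.carrier, inner ℝ (F.T x) (η₁ - η₂) = F.logZ η₁ - F.logZ η₂ := by
  have hzero : ∫ x, (F.sqrtDensity η₁ x - F.sqrtDensity η₂ x) ^ 2 ∂F.carrier = 0 :=
    le_antisymm ((integral_sqrtDensity_sub_sq_le hF hy h₁ h₂).trans (by rw [hg₁, hg₂, add_zero]))
      (integral_nonneg fun x => sq_nonneg _)
  filter_upwards [(integral_eq_zero_iff_of_nonneg (fun x => sq_nonneg _)
    (integrable_sqrtDensity_sub_sq h₁ h₂)).1 hzero] with x hx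
  have h := Real.exp_injective (sub_eq_zero.1 (pow_eq_zero_iff two_ne_zero |>.1 hx))
  rw [inner_sub_right]; linarith

/-- A minimiser of the gap at an interior point of `dom A*` is unique: otherwise `⟨T, v⟩` is almost
everywhere constant for some `v ≠ 0`, and `dom A*` lies in a hyperplane orthogonal to `v`. -/
lemma eq_of_gap_eq_zero (hF : F.IsRegular) {y η₁ η₂ : EuclideanSpace ℝ (Fin k)}
    (hy : y ∈ interior F.conjDom) (h₁ : η₁ ∈ F.naturalSpace) (h₂ : η₂ ∈ F.naturalSpace)
    (hg₁ : F.gap y η₁ = 0) (hg₂ : F.gap y η₂ = 0) : η₁ = η₂ := by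
  have hae := inner_ae_eq_of_gap_eq_zero hF (interior_subset hy) h₁ h₂ hg₁ hg₂
  set v := η₁ - η₂ with hv
  set c := F.logZ η₁ - F.logZ η₂
  have hpart : ∀ s : ℝ, F.partition (η₁ + s • v)
      = ENNReal.ofReal (Real.exp (F.logZ η₁ + s * c)) := fun s => by
    rw [partition_eq, Real.exp_add, mul_comm, ENNReal.ofReal_mul (Real.exp_nonneg _),
      ← partition_eq_exp hF h₁, partition_eq,
      ← lintegral_const_mul _ (F.measurable_inner_T η₁).exp.ennreal_ofReal]
    refine lintegral_congr_ae (hae.mono fun x hx => ?_)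
    simp only
    rw [inner_add_right, real_inner_smul_right, hx, add_comm, Real.exp_add,
      ENNReal.ofReal_mul (Real.exp_nonneg _)]
  have hdom : ∀ w ∈ F.conjDom, inner ℝ w v = c := fun w hw => by
    have key : ∀ s : ℝ, s * (inner ℝ w v - c) ≤ F.gap w η₁ := fun s => by
      have hN := mem_naturalSpace_of_le (hpart s).le
      have hZ : F.logZ (η₁ + s • v) ≤ F.logZ η₁ + s * c :=
        logZ_le_of_partition_le hF (hpart s).le
      have h := gap_nonneg hF hw hN
      rw [gap, inner_add_right, real_inner_smul_right] at h
      rw [gap]; linarith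
    by_contra hne
    have hne' : inner ℝ w v - c ≠ 0 := sub_ne_zero.2 hne
    have h := key ((F.gap w η₁ + 1) / (inner ℝ w v - c))
    rw [div_mul_cancel₀ _ hne'] at h
    linarith
  obtain ⟨δ, hδ, hball⟩ := Metric.mem_nhds_iff.1 (mem_interior_iff_mem_nhds.1 hy)
  by_contra hne
  have hv0 : 0 < ‖v‖ := norm_pos_iff.2 (sub_ne_zero.2 hne)
  have hmem : y + (δ / 2 / ‖v‖) • v ∈ F.conjDom := hball (by
    rw [Metric.mem_ball, dist_self_add_left, norm_smul, Real.norm_of_nonneg (by positivity),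
      div_mul_cancel₀ _ hv0.ne']
    linarith)
  have e1 := hdom _ hmem
  rw [inner_add_left, real_inner_smul_left, hdom y (interior_subset hy),
    real_inner_self_eq_norm_sq] at e1
  have : 0 < δ / 2 / ‖v‖ * ‖v‖ ^ 2 := by positivity
  linarith

/-- Parameters that nearly minimise the gap at an interior point converge to a minimiser. -/
lemma exists_tendsto_gap_eq_zero (hF : F.IsRegular) {y : EuclideanSpace ℝ (Fin k)}
    (hy : y ∈ interior F.conjDom) {η : ℕ → EuclideanSpace ℝ (Fin k)}
    (hη : ∀ n, η n ∈ F.naturalSpace)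
    (hgap : Filter.Tendsto (fun n => F.gap y (η n)) Filter.atTop (nhds 0)) :
    ∃ x ∈ F.naturalSpace, F.gap y x = 0 ∧ Filter.Tendsto η Filter.atTop (nhds x) := by
  obtain ⟨r, hr, hle⟩ := exists_norm_le_gap hF hy
  obtain ⟨B, hB⟩ := hgap.bddAbove_range
  have hbdd : ∀ n, η n ∈ Metric.closedBall (0 : EuclideanSpace ℝ (Fin k)) ((B + 1) / r) :=
    fun n => by
      rw [mem_closedBall_zero_iff, le_div_iff₀ hr, mul_comm]
      linarith [hle _ (hη n), hB (mem_range_self n)]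
  have hsub : ∀ ns : ℕ → ℕ, Filter.Tendsto ns Filter.atTop Filter.atTop →
      ∃ x ∈ F.naturalSpace, F.gap y x = 0 ∧
        ∃ ms : ℕ → ℕ, Filter.Tendsto (fun n => η (ns (ms n))) Filter.atTop (nhds x) := by
    intro ns hns
    obtain ⟨x, -, ms, hms, hx⟩ := (isCompact_closedBall (0 : EuclideanSpace ℝ (Fin k))
      ((B + 1) / r)).tendsto_subseq fun n => hbdd (ns n)
    obtain ⟨hxN, hx0⟩ := gap_eq_zero_of_tendsto hF (interior_subset hy) (fun n => hη (ns (ms n)))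
      (hgap.comp (hns.comp hms.tendsto_atTop)) hx
    exact ⟨x, hxN, hx0, ms, hx⟩
  obtain ⟨x, hxN, hx0, -⟩ := hsub id Filter.tendsto_id
  refine ⟨x, hxN, hx0, Filter.tendsto_of_subseq_tendsto fun ns hns => ?_⟩
  obtain ⟨x', hxN', hx0', ms, hms⟩ := hsub ns hns
  exact ⟨ms, eq_of_gap_eq_zero hF hy hxN hxN' hx0 hx0' ▸ hms⟩

lemma exists_gap_eq_zero (hF : F.IsRegular) {y : EuclideanSpace ℝ (Fin k)}
    (hy : y ∈ interior F.conjDom) : ∃ η ∈ F.naturalSpace, F.gap y η = 0 := by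
  choose η hη hgap using fun n : ℕ =>
    exists_gap_lt hF (y := y) (Nat.one_div_pos_of_nat (α := ℝ) (n := n))
  obtain ⟨x, hx, hx0, -⟩ := exists_tendsto_gap_eq_zero hF hy hη
    (squeeze_zero (fun n => gap_nonneg hF (interior_subset hy) (hη n)) (fun n => (hgap n).le)
      tendsto_one_div_add_atTop_nhds_zero_nat)
  exact ⟨x, hx, hx0⟩

/-- Measurable selection of the maximisers in the definition of `A*` over interior points: they
are limits of measurable near-maximisers. -/
lemma exists_measurable_gap_eq_zero (hF : F.IsRegular) {Z : Type*} [MeasurableSpace Z]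
    {Y : Z → EuclideanSpace ℝ (Fin k)} (hY : Measurable Y) :
    ∃ η : Z → EuclideanSpace ℝ (Fin k), Measurable η ∧ ∀ z, η z ∈ F.naturalSpace ∧
      (Y z ∈ interior F.conjDom → F.gap (Y z) (η z) = 0) := by
  classical
  choose η hηm hη using fun n : ℕ =>
    exists_measurable_gap_lt hF hY (Nat.one_div_pos_of_nat (α := ℝ) (n := n))
  obtain ⟨η₀, hη₀⟩ := hF.2.1
  have hlim : ∀ z, Y z ∈ interior F.conjDom → ∃ x ∈ F.naturalSpace, F.gap (Y z) x = 0 ∧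
      Filter.Tendsto (fun n => η n z) Filter.atTop (nhds x) := fun z hz =>
    exists_tendsto_gap_eq_zero hF hz (fun n => (hη n z).1)
      (squeeze_zero (fun n => gap_nonneg hF (interior_subset hz) (hη n z).1)
        (fun n => (hη n z).2.le) tendsto_one_div_add_atTop_nhds_zero_nat)
  have hS : MeasurableSet {z | Y z ∈ interior F.conjDom} := hY isOpen_interior.measurableSet
  let L : Z → EuclideanSpace ℝ (Fin k) := fun z =>
    if hz : Y z ∈ interior F.conjDom then (hlim z hz).choose else η₀
  refine ⟨L, ?_, fun z => ?_⟩
  · refine measurable_of_tendsto_metrizable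
      (f := fun n z => if Y z ∈ interior F.conjDom then η n z else η₀)
      (fun n => Measurable.ite hS (hηm n) measurable_const) (tendsto_pi_nhds.2 fun z => ?_)
    by_cases hz : Y z ∈ interior F.conjDom
    · simp only [L, hz, if_true, dif_pos]
      exact (hlim z hz).choose_spec.2.2
    · simp only [L, hz, if_false, dif_neg, not_false_eq_true]
      exact tendsto_const_nhds
  · by_cases hz : Y z ∈ interior F.conjDom
    · simp only [L, hz, dif_pos]
      exact ⟨(hlim z hz).choose_spec.1, fun _ => (hlim z hz).choose_spec.2.1⟩
    · simp only [L, hz, dif_neg, not_false_eq_true]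
      exact ⟨hη₀, fun h => h.elim⟩

/-! ### Equality in Jensen's inequality for the conjugate -/

/-- The derivative of a moment generating function at `0` determines the slope of an exponential
`s ↦ exp (s c)` that touches it there from below. -/
lemma eq_of_exp_mul_le_integral {X : Type*} [MeasurableSpace X] {μ : Measure X} {U g : X → ℝ}
    (hg : Measurable g) {c₁ c₂ : ℝ}
    (hint : ∀ᶠ s in nhds (0 : ℝ), Integrable (fun x => Real.exp (g x + s * U x)) μ)
    (hpos : 0 < ∫ x, Real.exp (g x) ∂μ)
    (h₁ : ∀ᶠ s in nhds (0 : ℝ),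
      Real.exp (s * c₁) * ∫ x, Real.exp (g x) ∂μ ≤ ∫ x, Real.exp (g x + s * U x) ∂μ)
    (h₂ : ∀ᶠ s in nhds (0 : ℝ),
      Real.exp (s * c₂) * ∫ x, Real.exp (g x) ∂μ ≤ ∫ x, Real.exp (g x + s * U x) ∂μ) :
    c₁ = c₂ := by
  set ρ : Measure X := μ.withDensity fun x => ENNReal.ofReal (Real.exp (g x)) with hρ
  have hmul : ∀ (s : ℝ) (x : X), (ENNReal.ofReal (Real.exp (g x))).toReal • Real.exp (s * U x)
      = Real.exp (g x + s * U x) := fun s x => by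
    rw [ENNReal.toReal_ofReal (Real.exp_nonneg _), smul_eq_mul, ← Real.exp_add]
  have hmgf : ∀ s, mgf U ρ s = ∫ x, Real.exp (g x + s * U x) ∂μ := fun s => by
    rw [mgf, hρ, integral_withDensity_eq_integral_toReal_smul hg.exp.ennreal_ofReal
      (.of_forall fun _ => ENNReal.ofReal_lt_top)]
    simp only [hmul]
  have hmem : (0 : ℝ) ∈ interior (integrableExpSet U ρ) := by
    refine mem_interior_iff_mem_nhds.2 (hint.mono fun s hs => ?_)
    rw [hρ, integrable_withDensity_iff_integrable_smul'
      hg.exp.ennreal_ofReal (.of_forall fun _ => ENNReal.ofReal_lt_top)]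
    simpa only [hmul] using hs
  -- `mgf U ρ s - exp (s c) ∫ exp g` is minimal at `s = 0`, which determines `c`.
  have hderiv := hasDerivAt_mgf hmem
  set D : ℝ := ∫ x, (fun ω => U ω * Real.exp (0 * U ω)) x ∂ρ
  have key : ∀ c : ℝ, (∀ᶠ s in nhds (0 : ℝ),
      Real.exp (s * c) * ∫ x, Real.exp (g x) ∂μ ≤ ∫ x, Real.exp (g x + s * U x) ∂μ) →
      D = c * ∫ x, Real.exp (g x) ∂μ := fun c hc => by
    have hd : HasDerivAt (fun s => mgf U ρ s - Real.exp (s * c) * ∫ x, Real.exp (g x) ∂μ)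
        (D - (Real.exp (0 * c) * (1 * c)) * ∫ x, Real.exp (g x) ∂μ) 0 :=
      hderiv.sub ((((hasDerivAt_id (0 : ℝ)).mul_const c).exp).mul_const _)
    have hmin : IsLocalMin
        (fun s => mgf U ρ s - Real.exp (s * c) * ∫ x, Real.exp (g x) ∂μ) 0 := by
      refine hc.mono fun s hs => ?_
      simp only [hmgf, zero_mul, add_zero, Real.exp_zero, one_mul, sub_self]
      linarith
    have h0 := hmin.hasDerivAt_eq_zero hd
    simp only [zero_mul, Real.exp_zero, one_mul] at h0
    linarith
  exact mul_right_cancel₀ hpos.ne' ((key c₁ h₁).symm.trans (key c₂ h₂))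

/-- `A` is differentiable at a natural parameter, so the same parameter cannot attain the supremum
defining `A*` at two points. -/
lemma eq_of_gap_eq_zero_left (hF : F.IsRegular) {y₁ y₂ η : EuclideanSpace ℝ (Fin k)}
    (h₁ : y₁ ∈ F.conjDom) (h₂ : y₂ ∈ F.conjDom) (hη : η ∈ F.naturalSpace)
    (hg₁ : F.gap y₁ η = 0) (hg₂ : F.gap y₂ η = 0) : y₁ = y₂ := by
  have hev : ∀ᶠ s in nhds (0 : ℝ), η + s • (y₁ - y₂) ∈ F.naturalSpace := by
    have hc : ContinuousAt (fun s : ℝ => η + s • (y₁ - y₂)) 0 := by fun_prop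
    exact hc.eventually_mem (hF.2.2.mem_nhds (by simpa using hη))
  have hexp : ∀ (s : ℝ) (x : X), Real.exp (inner ℝ (F.T x) η + s * inner ℝ (F.T x) (y₁ - y₂))
      = Real.exp (inner ℝ (F.T x) (η + s • (y₁ - y₂))) := fun s x => by
    rw [inner_add_right, real_inner_smul_right]
  have key : ∀ y ∈ F.conjDom, F.gap y η = 0 → ∀ᶠ s in nhds (0 : ℝ),
      Real.exp (s * inner ℝ y (y₁ - y₂)) * ∫ x, Real.exp (inner ℝ (F.T x) η) ∂F.carrier
        ≤ ∫ x, Real.exp (inner ℝ (F.T x) η + s * inner ℝ (F.T x) (y₁ - y₂)) ∂F.carrier := by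
    intro y hy hgy
    filter_upwards [hev] with s hs
    simp only [hexp]
    rw [integral_exp hF hs, integral_exp hF hη, ← Real.exp_add, Real.exp_le_exp]
    have h := gap_nonneg hF hy hs
    rw [gap] at h hgy
    rw [inner_add_right, real_inner_smul_right] at h
    linarith
  have h := eq_of_exp_mul_le_integral (F.measurable_inner_T η)
    (hev.mono fun s hs => by simpa only [hexp] using integrable_exp hs)
    (by rw [integral_exp hF hη]; exact Real.exp_pos _) (key y₁ h₁ hg₁) (key y₂ h₂ hg₂)
  rwa [← sub_eq_zero, ← inner_sub_left, inner_self_eq_zero, sub_eq_zero] at h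

lemma mix_mem_conjDom (hF : F.IsRegular) {y₁ y₂ : EuclideanSpace ℝ (Fin k)}
    (h₁ : y₁ ∈ F.conjDom) (h₂ : y₂ ∈ F.conjDom) {a : ℝ} (ha : a ∈ Icc (0 : ℝ) 1) :
    a • y₁ + (1 - a) • y₂ ∈ F.conjDom :=
  (convexOn_conj hF).1 h₁ h₂ ha.1 (sub_nonneg.2 ha.2) (by ring)

lemma jensenGap_nonneg (hF : F.IsRegular) {y₁ y₂ : EuclideanSpace ℝ (Fin k)}
    (h₁ : y₁ ∈ F.conjDom) (h₂ : y₂ ∈ F.conjDom) {a : ℝ} (ha : a ∈ Icc (0 : ℝ) 1) :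
    0 ≤ jensenGap (convexConjugate F.A) y₁ y₂ a :=
  sub_nonneg.2 ((convexOn_conj hF).2 h₁ h₂ ha.1 (sub_nonneg.2 ha.2) (by ring))

/-- The Jensen gap of a convex function is concave in the weight, so that it vanishes identically
once it vanishes at an interior weight. -/
lemma jensenGap_eq_zero_of_eq_zero (hF : F.IsRegular) {y₁ y₂ : EuclideanSpace ℝ (Fin k)}
    (h₁ : y₁ ∈ F.conjDom) (h₂ : y₂ ∈ F.conjDom) {a b : ℝ} (ha : a ∈ Ioo (0 : ℝ) 1)
    (hb : b ∈ Ioo (0 : ℝ) 1) (h : jensenGap (convexConjugate F.A) y₁ y₂ a = 0) :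
    jensenGap (convexConjugate F.A) y₁ y₂ b = 0 := by
  refine le_antisymm ?_ (jensenGap_nonneg hF h₁ h₂ ⟨hb.1.le, hb.2.le⟩)
  have hyb := mix_mem_conjDom hF h₁ h₂ (a := b) ⟨hb.1.le, hb.2.le⟩
  change a * F.conj y₁ + (1 - a) * F.conj y₂ - F.conj (a • y₁ + (1 - a) • y₂) = 0 at h
  change b * F.conj y₁ + (1 - b) * F.conj y₂ - F.conj (b • y₁ + (1 - b) • y₂) ≤ 0
  rcases le_total b a with hab | hab
  · have hb' : 0 < 1 - b := by linarith [hb.2]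
    set l := (1 - a) / (1 - b)
    have hl : l * (1 - b) = 1 - a := div_mul_cancel₀ _ hb'.ne'
    have hl0 : 0 < l := div_pos (by linarith [ha.2]) hb'
    have hl1 : l ≤ 1 := (div_le_one hb').2 (by linarith)
    have hmix : l • (b • y₁ + (1 - b) • y₂) + (1 - l) • y₁ = a • y₁ + (1 - a) • y₂ := by
      rw [← hl, smul_add, smul_smul, smul_smul, add_right_comm, ← add_smul]
      congr 2; linear_combination -hl
    have hc := (convexOn_conj hF).2 hyb h₁ hl0.le (sub_nonneg.2 hl1) (by ring)
    rw [hmix, smul_eq_mul, smul_eq_mul] at hc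
    have : l * (b * F.conj y₁ + (1 - b) * F.conj y₂ - F.conj (b • y₁ + (1 - b) • y₂)) ≤ 0 := by
      linear_combination hc + h + hl * (F.conj y₂ - F.conj y₁)
    exact nonpos_of_mul_nonpos_right this hl0
  · set l := a / b
    have hl : l * b = a := div_mul_cancel₀ _ hb.1.ne'
    have hl0 : 0 < l := div_pos ha.1 hb.1
    have hl1 : l ≤ 1 := (div_le_one hb.1).2 hab
    have hmix : l • (b • y₁ + (1 - b) • y₂) + (1 - l) • y₂ = a • y₁ + (1 - a) • y₂ := by
      rw [← hl, smul_add, smul_smul, smul_smul, add_assoc, ← add_smul]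
      congr 2; ring
    have hc := (convexOn_conj hF).2 hyb h₂ hl0.le (sub_nonneg.2 hl1) (by ring)
    rw [hmix, smul_eq_mul, smul_eq_mul] at hc
    have : l * (b * F.conj y₁ + (1 - b) * F.conj y₂ - F.conj (b • y₁ + (1 - b) • y₂)) ≤ 0 := by
      linear_combination hc + h + hl * (F.conj y₁ - F.conj y₂)
    exact nonpos_of_mul_nonpos_right this hl0

/-- The maximiser at an interior mixture is also a maximiser at both endpoints. -/
lemma eq_of_jensenGap_eq_zero_of_interior (hF : F.IsRegular) {y₁ y₂ : EuclideanSpace ℝ (Fin k)}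
    (h₁ : y₁ ∈ F.conjDom) (h₂ : y₂ ∈ F.conjDom) {a : ℝ} (ha : a ∈ Ioo (0 : ℝ) 1)
    (hint : a • y₁ + (1 - a) • y₂ ∈ interior F.conjDom)
    (h : jensenGap (convexConjugate F.A) y₁ y₂ a = 0) : y₁ = y₂ := by
  obtain ⟨η, hη, hgap⟩ := exists_gap_eq_zero hF hint
  have hmix := gap_mix (F := F) y₁ y₂ η a
  rw [h, hgap, add_zero] at hmix
  have ha' : 0 < 1 - a := sub_pos.2 ha.2
  have hz := (add_eq_zero_iff_of_nonneg (mul_nonneg ha.1.le (gap_nonneg hF h₁ hη))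
    (mul_nonneg ha'.le (gap_nonneg hF h₂ hη))).1 hmix
  exact eq_of_gap_eq_zero_left hF h₁ h₂ hη ((mul_eq_zero.1 hz.1).resolve_left ha.1.ne')
    ((mul_eq_zero.1 hz.2).resolve_left ha'.ne')

/-! ### Limits of maximising sequences when every parameter is natural -/

/-- A pointwise limit of affine functions of a statistic with values in a finite-dimensional space
is again an affine function of the statistic. -/
lemma exists_affine_limit {X : Type*} (T : X → EuclideanSpace ℝ (Fin k)) (S : Set X)
    (η : ℕ → EuclideanSpace ℝ (Fin k)) (b : ℕ → ℝ)
    (h : ∀ x ∈ S, ∃ l : ℝ, Filter.Tendsto (fun n => inner ℝ (T x) (η n) - b n)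
      Filter.atTop (nhds l)) :
    ∃ (η' : EuclideanSpace ℝ (Fin k)) (b' : ℝ), ∀ x ∈ S,
      Filter.Tendsto (fun n => inner ℝ (T x) (η n) - b n) Filter.atTop
        (nhds (inner ℝ (T x) η' - b')) := by
  choose g hg using fun x : S => h x x.2
  let Φ : (EuclideanSpace ℝ (Fin k) × ℝ) →ₗ[ℝ] (S → ℝ) :=
    { toFun := fun w x => inner ℝ (T x) w.1 - w.2
      map_add' := fun u w => by
        funext x; simp only [Prod.fst_add, Prod.snd_add, inner_add_right, Pi.add_apply]; ring
      map_smul' := fun c w => by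
        funext x
        simp only [Prod.smul_fst, Prod.smul_snd, real_inner_smul_right, Pi.smul_apply,
          smul_eq_mul, RingHom.id_apply]
        ring }
  have hclosed : IsClosed (LinearMap.range Φ : Set (S → ℝ)) :=
    Submodule.closed_of_finiteDimensional _
  have hlim : Filter.Tendsto (fun n => Φ (η n, b n)) Filter.atTop (nhds g) :=
    tendsto_pi_nhds.2 hg
  obtain ⟨w, hw⟩ : g ∈ LinearMap.range Φ :=
    hclosed.mem_of_tendsto hlim (.of_forall fun n => ⟨_, rfl⟩)
  refine ⟨w.1, w.2, fun x hx => ?_⟩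
  have := hg ⟨x, hx⟩
  rwa [← hw] at this

/-- The geometric rate of the gaps makes the `L²` distances summable, which gives almost sure
convergence. -/
lemma ae_exists_tendsto_sqrtDensity (hF : F.IsRegular) {y : EuclideanSpace ℝ (Fin k)}
    (hy : y ∈ F.conjDom) {η : ℕ → EuclideanSpace ℝ (Fin k)} (hη : ∀ n, η n ∈ F.naturalSpace)
    (hgap : ∀ n, F.gap y (η n) ≤ (1 / 4) ^ n) :
    ∀ᵐ x ∂F.carrier, ∃ l : ℝ,
      Filter.Tendsto (fun n => F.sqrtDensity (η n) x) Filter.atTop (nhds l) := by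
  have hB : ∑' N : ℕ, ENNReal.ofReal (2 * (1 / 2) ^ N) ≠ ∞ := by
    rw [← ENNReal.ofReal_tsum_of_nonneg (fun _ => by positivity)
      (summable_geometric_two.mul_left 2)]
    exact ENNReal.ofReal_ne_top
  refine Lp.ae_tendsto_of_cauchy_eLpNorm (p := 2)
    (fun n => (F.measurable_sqrtDensity _).aestronglyMeasurable) (by norm_num) hB
    fun N n m hn hm => ?_
  have hint := integrable_sqrtDensity_sub_sq (hη n) (hη m)
  have hmem : MemLp (F.sqrtDensity (η n) - F.sqrtDensity (η m)) 2 F.carrier :=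
    (memLp_two_iff_integrable_sq ((F.measurable_sqrtDensity _).sub
      (F.measurable_sqrtDensity _)).aestronglyMeasurable).2 hint
  rw [hmem.eLpNorm_eq_integral_rpow_norm two_ne_zero ENNReal.ofNat_ne_top]
  refine (ENNReal.ofReal_lt_ofReal_iff (by positivity)).2 ?_
  simp only [ENNReal.toReal_ofNat, Real.rpow_ofNat, Pi.sub_apply, Real.norm_eq_abs, sq_abs]
  rw [inv_eq_one_div, ← Real.sqrt_eq_rpow]
  refine (Real.sqrt_lt' (by positivity)).2 ?_
  have h := integral_sqrtDensity_sub_sq_le hF hy (hη n) (hη m)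
  have h1 : ∀ j, N ≤ j → F.gap y (η j) ≤ (1 / 4) ^ N := fun j hj =>
    (hgap j).trans (pow_le_pow_of_le_one (by norm_num) (by norm_num) hj)
  have h2 : (2 * (1 / 2 : ℝ) ^ N) ^ 2 = 4 * (1 / 4) ^ N := by
    rw [mul_pow, ← pow_mul, mul_comm N 2, pow_mul]; norm_num
  have h3 : (0 : ℝ) < (1 / 4) ^ N := by positivity
  rw [h2]
  linarith [h1 n hn, h1 m hm]

/-- The almost sure limit of the densities along a maximising sequence: an exponential density on
a measurable set `S`, and zero outside. When the supremum defining `A*` is not attained, the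
complement of `S` may have positive measure, as it does for a finite sample space and `y` on the
boundary of the convex support. -/
lemma exists_ae_tendsto_sqrtDensity (hF : F.IsRegular) {y : EuclideanSpace ℝ (Fin k)}
    (hy : y ∈ F.conjDom) {η : ℕ → EuclideanSpace ℝ (Fin k)} (hη : ∀ n, η n ∈ F.naturalSpace)
    (hgap : ∀ n, F.gap y (η n) ≤ (1 / 4) ^ n) :
    ∃ (S : Set X) (η' : EuclideanSpace ℝ (Fin k)) (b : ℝ), MeasurableSet S ∧
      ∀ᵐ x ∂F.carrier, Filter.Tendsto (fun n => F.sqrtDensity (η n) x) Filter.atTop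
        (nhds (S.indicator (fun x => Real.exp ((inner ℝ (F.T x) η' - b) / 2)) x)) := by
  obtain ⟨η', b, hlim⟩ := exists_affine_limit F.T
    {x | ∃ l : ℝ, 0 < l ∧
      Filter.Tendsto (fun n => F.sqrtDensity (η n) x) Filter.atTop (nhds l)}
    η (fun n => F.logZ (η n)) (by
      rintro x ⟨l, hl, hx⟩
      refine ⟨2 * Real.log l, ?_⟩
      have := (((Real.continuousAt_log hl.ne').tendsto.comp hx).const_mul 2)
      refine this.congr fun n => ?_
      simp only [Function.comp, sqrtDensity, Real.log_exp]
      ring)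
  -- Defining `S` by convergence to the measurable candidate limit makes it measurable.
  refine ⟨{x | Filter.Tendsto (fun n => F.sqrtDensity (η n) x) Filter.atTop
    (nhds (Real.exp ((inner ℝ (F.T x) η' - b) / 2)))}, η', b,
    measurableSet_tendsto_fun (fun n => F.measurable_sqrtDensity _)
      (((F.measurable_inner_T η').sub_const _).div_const _).exp, ?_⟩
  filter_upwards [ae_exists_tendsto_sqrtDensity hF hy hη hgap] with x ⟨l, hl⟩
  by_cases hx : Filter.Tendsto (fun n => F.sqrtDensity (η n) x) Filter.atTop
    (nhds (Real.exp ((inner ℝ (F.T x) η' - b) / 2)))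
  · rwa [indicator_of_mem (by exact hx)]
  · rw [indicator_of_notMem (by exact hx)]
    have hl0 : 0 ≤ l := ge_of_tendsto' hl fun n => (sqrtDensity_pos _ _).le
    rcases hl0.eq_or_lt with rfl | hpos
    · exact hl
    · refine absurd ?_ hx
      exact (Real.continuous_exp.tendsto _).comp ((hlim x ⟨l, hpos, hl⟩).div_const 2)

/-- Young's inequality `exp (u) ^ (1 - t) exp w ≤ δ exp u + c exp (w / t)`, with a maximum in place
of the sum. -/
lemma exp_convex_comb_le {t δ : ℝ} (ht : 0 < t) (ht1 : t < 1) (hδ : 0 < δ) (u w : ℝ) :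
    Real.exp ((1 - t) * u + w)
      ≤ max (δ * Real.exp u) (Real.exp (-((1 - t) / t * Real.log δ)) * Real.exp (t⁻¹ * w)) := by
  rw [← Real.exp_add]
  rcases le_total w (t * u + Real.log δ) with h | h
  · refine le_max_of_le_left ?_
    calc Real.exp ((1 - t) * u + w) ≤ Real.exp (Real.log δ + u) := by
          rw [Real.exp_le_exp]; linarith
      _ = δ * Real.exp u := by rw [Real.exp_add, Real.exp_log hδ]
  · refine le_max_of_le_right (Real.exp_le_exp.2 ?_)
    have h1 : (1 - t) * (t * u + Real.log δ) ≤ (1 - t) * w :=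
      mul_le_mul_of_nonneg_left h (by linarith)
    have h2 : (1 - t) * u + w = t⁻¹ * ((1 - t) * (t * u) + t * w) := by field_simp
    have h3 : -((1 - t) / t * Real.log δ) + t⁻¹ * w = t⁻¹ * (w - (1 - t) * Real.log δ) := by
      field_simp; ring
    rw [h2, h3]
    exact mul_le_mul_of_nonneg_left (by linarith) (inv_pos.2 ht).le

/-- Let `p_n → 𝟙_S exp (⟨T, η'⟩ - b)` be the almost sure limit of densities of the family whose
gaps at `y` tend to zero. The inequality `∫ p_n ^ (1 - t) exp ⟨T, ζ⟩ ≥ exp (⟨y, ζ⟩ - t A*(y) - o(1))`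
passes to the limit, because Young's inequality dominates the integrand by `δ p_n` plus a fixed
integrable function. -/
lemma exp_le_integral_limit (hF : F.IsRegular) (hN : F.naturalSpace = univ)
    {y : EuclideanSpace ℝ (Fin k)} (hy : y ∈ F.conjDom) {η : ℕ → EuclideanSpace ℝ (Fin k)}
    (hgap : Filter.Tendsto (fun n => F.gap y (η n)) Filter.atTop (nhds 0))
    {S : Set X} (hS : MeasurableSet S) {η' : EuclideanSpace ℝ (Fin k)} {b : ℝ}
    (hlim : ∀ᵐ x ∂F.carrier, Filter.Tendsto (fun n => F.sqrtDensity (η n) x) Filter.atTop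
        (nhds (S.indicator (fun x => Real.exp ((inner ℝ (F.T x) η' - b) / 2)) x)))
    {t : ℝ} (ht : 0 < t) (ht1 : t < 1) (ζ : EuclideanSpace ℝ (Fin k)) :
    Real.exp (inner ℝ y ζ - t * F.conj y) ≤
      ∫ x in S, Real.exp ((1 - t) * (inner ℝ (F.T x) η' - b) + inner ℝ (F.T x) ζ) ∂F.carrier := by
  have hmem : ∀ ξ, ξ ∈ F.naturalSpace := fun ξ => hN ▸ mem_univ ξ
  set v : X → ℝ :=
    fun x => Real.exp ((1 - t) * (inner ℝ (F.T x) η' - b) + inner ℝ (F.T x) ζ) with hv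
  have hv_eq : ∀ x, v x = Real.exp (-((1 - t) * b))
      * Real.exp (inner ℝ (F.T x) ((1 - t) • η' + ζ)) := fun x => by
    simp only [hv]
    rw [← Real.exp_add, inner_add_right, real_inner_smul_right]; congr 1; ring
  have hv_int : Integrable v F.carrier := by
    rw [funext hv_eq]; exact (integrable_exp (hmem _)).const_mul _
  set u : ℕ → X → ℝ := fun n x =>
    Real.exp ((1 - t) * (inner ℝ (F.T x) (η n) - F.logZ (η n)) + inner ℝ (F.T x) ζ) with hu
  have hu_eq : ∀ n x, u n x = Real.exp (-((1 - t) * F.logZ (η n)))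
      * Real.exp (inner ℝ (F.T x) ((1 - t) • η n + ζ)) := fun n x => by
    simp only [hu]
    rw [← Real.exp_add, inner_add_right, real_inner_smul_right]; congr 1; ring
  have hu_int : ∀ n, Integrable (u n) F.carrier := fun n => by
    rw [funext (hu_eq n)]; exact (integrable_exp (hmem _)).const_mul _
  have hlower : ∀ n, Real.exp (inner ℝ y ζ - t * F.conj y - (1 - t) * F.gap y (η n))
      ≤ ∫ x, u n x ∂F.carrier := fun n => by
    simp only [hu_eq]
    rw [integral_const_mul, integral_exp hF (hmem _), ← Real.exp_add, Real.exp_le_exp]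
    have h := gap_nonneg hF hy (hmem ((1 - t) • η n + ζ))
    simp only [gap, inner_add_right, real_inner_smul_right] at h ⊢
    linarith
  -- The almost sure limit of the integrands, through `u n = f_n ^ (2 (1 - t)) exp ⟨T, ζ⟩`
  -- with `f_n` the square roots of the densities.
  have hu_lim : ∀ᵐ x ∂F.carrier,
      Filter.Tendsto (fun n => u n x) Filter.atTop (nhds (S.indicator v x)) := by
    have ht' : 0 < 2 * (1 - t) := by linarith
    filter_upwards [hlim] with x hx
    have h1 := ((Real.continuousAt_rpow_const _ _ (Or.inr ht'.le)).tendsto.comp hx).mul_const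
      (Real.exp (inner ℝ (F.T x) ζ))
    have h2 : ∀ s r : ℝ, Real.exp (s / 2) ^ (2 * (1 - t)) * Real.exp r
        = Real.exp ((1 - t) * s + r) := fun s r => by
      rw [← Real.exp_mul, ← Real.exp_add]; congr 1; ring
    have h3 : S.indicator (fun x => Real.exp ((inner ℝ (F.T x) η' - b) / 2)) x ^ (2 * (1 - t))
        * Real.exp (inner ℝ (F.T x) ζ) = S.indicator v x := by
      by_cases hxS : x ∈ S
      · rw [indicator_of_mem hxS, indicator_of_mem hxS, h2]
      · rw [indicator_of_notMem hxS, indicator_of_notMem hxS, Real.zero_rpow ht'.ne', zero_mul]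
    rw [h3] at h1
    exact h1.congr fun n => h2 _ _
  have hmain : ∀ δ > 0, Real.exp (inner ℝ y ζ - t * F.conj y)
      ≤ ∫ x, S.indicator v x ∂F.carrier + δ := by
    intro δ hδ
    set W : X → ℝ := fun x => Real.exp (-((1 - t) / t * Real.log δ))
      * Real.exp (inner ℝ (F.T x) (t⁻¹ • ζ)) with hW
    have hW_int : Integrable W F.carrier := (integrable_exp (hmem _)).const_mul _
    have hW0 : ∀ x, 0 ≤ W x := fun x => by positivity
    have hdom : Filter.Tendsto (fun n => ∫ x, min (u n x) (W x) ∂F.carrier) Filter.atTop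
        (nhds (∫ x, min (S.indicator v x) (W x) ∂F.carrier)) := by
      refine tendsto_integral_of_dominated_convergence W
        (fun n => ((hu_int n).inf hW_int).aestronglyMeasurable) hW_int
        (fun n => .of_forall fun x => ?_) (hu_lim.mono fun x hx => hx.min tendsto_const_nhds)
      rw [Real.norm_of_nonneg (le_min (Real.exp_nonneg _) (hW0 x))]
      exact min_le_right _ _
    have hle : ∀ n, ∫ x, u n x ∂F.carrier ≤ ∫ x, min (u n x) (W x) ∂F.carrier + δ := fun n => by
      have hmin_int : Integrable (fun x => min (u n x) (W x)) F.carrier := (hu_int n).inf hW_int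
      have hsq := (integrable_sqrtDensity_sq (hmem (η n))).const_mul δ
      have h1 : ∫ x, u n x ∂F.carrier
          ≤ ∫ x, (min (u n x) (W x) + δ * F.sqrtDensity (η n) x ^ 2) ∂F.carrier := by
        refine integral_mono (hu_int n) (hmin_int.add hsq) fun x => ?_
        have hY := exp_convex_comb_le ht ht1 hδ (inner ℝ (F.T x) (η n) - F.logZ (η n))
          (inner ℝ (F.T x) ζ)
        have hdens : Real.exp (inner ℝ (F.T x) (η n) - F.logZ (η n))
            = F.sqrtDensity (η n) x ^ 2 := by
          rw [sqrtDensity_sq, ← Real.exp_add, sub_eq_add_neg]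
        rw [← real_inner_smul_right, hdens] at hY
        have hp : 0 ≤ δ * F.sqrtDensity (η n) x ^ 2 := by positivity
        change u n x ≤ max _ (W x) at hY
        change u n x ≤ min (u n x) (W x) + δ * F.sqrtDensity (η n) x ^ 2
        rcases le_max_iff.1 hY with h | h
        · have : 0 ≤ min (u n x) (W x) := le_min (Real.exp_nonneg _) (hW0 x)
          linarith
        · rw [min_eq_left h]; linarith
      rwa [integral_add hmin_int hsq, integral_const_mul, integral_sqrtDensity_sq hF (hmem _),
        mul_one] at h1
    have hlow : Filter.Tendsto
        (fun n => Real.exp (inner ℝ y ζ - t * F.conj y - (1 - t) * F.gap y (η n)))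
        Filter.atTop (nhds (Real.exp (inner ℝ y ζ - t * F.conj y - (1 - t) * 0))) :=
      (Real.continuous_exp.tendsto _).comp (tendsto_const_nhds.sub (hgap.const_mul _))
    rw [mul_zero, sub_zero] at hlow
    refine (le_of_tendsto_of_tendsto' hlow (hdom.add_const δ)
      fun n => (hlower n).trans (hle n)).trans (add_le_add_left ?_ δ)
    have hvS := hv_int.indicator hS
    exact integral_mono (hvS.inf hW_int) hvS fun x => min_le_left _ _
  rw [← integral_indicator hS]
  exact le_of_forall_pos_le_add hmain

/-- The exponential moments of the limiting density dominate `ξ ↦ exp ⟨y, ξ⟩`. The bound of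
`exp_le_integral_limit` is applied at `ζ = t η' + ξ`, where the `t`-dependence of the right-hand
side is an explicit factor, and `t` tends to zero. -/
lemma exp_inner_le_integral_limit (hF : F.IsRegular) (hN : F.naturalSpace = univ)
    {y : EuclideanSpace ℝ (Fin k)} (hy : y ∈ F.conjDom) {η : ℕ → EuclideanSpace ℝ (Fin k)}
    (hgap : Filter.Tendsto (fun n => F.gap y (η n)) Filter.atTop (nhds 0))
    {S : Set X} (hS : MeasurableSet S) {η' : EuclideanSpace ℝ (Fin k)} {b : ℝ}
    (hlim : ∀ᵐ x ∂F.carrier, Filter.Tendsto (fun n => F.sqrtDensity (η n) x) Filter.atTop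
        (nhds (S.indicator (fun x => Real.exp ((inner ℝ (F.T x) η' - b) / 2)) x)))
    (ξ : EuclideanSpace ℝ (Fin k)) :
    Real.exp (inner ℝ y ξ + b) ≤
      ∫ x in S, Real.exp (inner ℝ (F.T x) (η' + ξ)) ∂F.carrier := by
  have hmain : ∀ t ∈ Ioo (0 : ℝ) 1,
      Real.exp (inner ℝ y ξ + b + t * (inner ℝ y η' - F.conj y - b))
        ≤ ∫ x in S, Real.exp (inner ℝ (F.T x) (η' + ξ)) ∂F.carrier := fun t ht => by
    have h := exp_le_integral_limit hF hN hy hgap hS hlim ht.1 ht.2 (t • η' + ξ)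
    have h1 : ∀ x, Real.exp ((1 - t) * (inner ℝ (F.T x) η' - b) + inner ℝ (F.T x) (t • η' + ξ))
        = Real.exp (inner ℝ (F.T x) (η' + ξ)) * Real.exp (-((1 - t) * b)) := fun x => by
      rw [← Real.exp_add, inner_add_right, inner_add_right, real_inner_smul_right]
      congr 1; ring
    simp only [h1] at h
    rw [integral_mul_const, Real.exp_neg, ← div_eq_mul_inv, le_div_iff₀ (Real.exp_pos _),
      ← Real.exp_add, inner_add_right, real_inner_smul_right] at h
    refine le_trans (le_of_eq ?_) h
    congr 1; ring
  have hcont : Filter.Tendsto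
      (fun t : ℝ => Real.exp (inner ℝ y ξ + b + t * (inner ℝ y η' - F.conj y - b)))
      (nhdsWithin 0 (Ioi 0)) (nhds (Real.exp (inner ℝ y ξ + b))) := by
    have : ContinuousAt
        (fun t : ℝ => Real.exp (inner ℝ y ξ + b + t * (inner ℝ y η' - F.conj y - b))) 0 := by
      fun_prop
    simpa using this.tendsto.mono_left nhdsWithin_le_nhds
  exact le_of_tendsto hcont
    (Filter.mem_of_superset (Ioo_mem_nhdsGT one_pos) hmain)

/-- By Fatou's lemma the limiting density has mass at most one. -/
lemma integral_limit_le (hF : F.IsRegular) (hN : F.naturalSpace = univ)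
    {η : ℕ → EuclideanSpace ℝ (Fin k)} {S : Set X} (hS : MeasurableSet S)
    {η' : EuclideanSpace ℝ (Fin k)} {b : ℝ}
    (hlim : ∀ᵐ x ∂F.carrier, Filter.Tendsto (fun n => F.sqrtDensity (η n) x) Filter.atTop
        (nhds (S.indicator (fun x => Real.exp ((inner ℝ (F.T x) η' - b) / 2)) x))) :
    ∫ x in S, Real.exp (inner ℝ (F.T x) η') ∂F.carrier ≤ Real.exp b := by
  have hmem : ∀ ξ, ξ ∈ F.naturalSpace := fun ξ => hN ▸ mem_univ ξ
  have hlint : ∫⁻ x in S, ENNReal.ofReal (Real.exp (inner ℝ (F.T x) η' - b)) ∂F.carrier ≤ 1 := by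
    rw [← lintegral_indicator hS]
    calc _ = ∫⁻ x, Filter.liminf (fun n => ENNReal.ofReal (F.sqrtDensity (η n) x ^ 2))
          Filter.atTop ∂F.carrier := by
          refine lintegral_congr_ae (hlim.mono fun x hx => ?_)
          have h1 := (ENNReal.tendsto_ofReal (hx.pow 2)).liminf_eq
          simp only [h1]
          by_cases hxS : x ∈ S
          · rw [indicator_of_mem hxS, indicator_of_mem hxS, ← Real.exp_nat_mul]
            congr 2; push_cast; ring
          · rw [indicator_of_notMem hxS, indicator_of_notMem hxS]; simp
      _ ≤ Filter.liminf (fun n => ∫⁻ x, ENNReal.ofReal (F.sqrtDensity (η n) x ^ 2) ∂F.carrier)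
          Filter.atTop :=
          lintegral_liminf_le fun n => ((F.measurable_sqrtDensity _).pow_const 2).ennreal_ofReal
      _ = 1 := by
          have : ∀ n, ∫⁻ x, ENNReal.ofReal (F.sqrtDensity (η n) x ^ 2) ∂F.carrier = 1 :=
            fun n => by
              rw [← ofReal_integral_eq_lintegral_ofReal (integrable_sqrtDensity_sq (hmem _))
                (.of_forall fun x => sq_nonneg _), integral_sqrtDensity_sq hF (hmem _),
                ENNReal.ofReal_one]
          simp only [this, Filter.liminf_const]
  have hint : Integrable (fun x => Real.exp (inner ℝ (F.T x) η' - b)) (F.carrier.restrict S) := by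
    simp only [Real.exp_sub]
    exact ((integrable_exp (hmem η')).restrict).div_const _
  rw [← ofReal_integral_eq_lintegral_ofReal hint (.of_forall fun x => Real.exp_nonneg _),
    ENNReal.ofReal_le_one] at hlint
  simp only [Real.exp_sub] at hlint
  rwa [integral_div, div_le_one (Real.exp_pos _)] at hlint

/-- If every parameter is natural, then `A*` is strictly convex on its whole effective domain,
boundary included. A vanishing Jensen gap makes one sequence of parameters maximising for both
endpoints, and the limit of the corresponding densities has both endpoints as its mean. -/
lemma eq_of_jensenGap_eq_zero_of_univ (hF : F.IsRegular) (hN : F.naturalSpace = univ)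
    {y₁ y₂ : EuclideanSpace ℝ (Fin k)}
    (h₁ : y₁ ∈ F.conjDom) (h₂ : y₂ ∈ F.conjDom) {a : ℝ} (ha : a ∈ Ioo (0 : ℝ) 1)
    (h : jensenGap (convexConjugate F.A) y₁ y₂ a = 0) : y₁ = y₂ := by
  have hmem : ∀ ξ, ξ ∈ F.naturalSpace := fun ξ => hN ▸ mem_univ ξ
  have ha' : 0 < 1 - a := sub_pos.2 ha.2
  have hmin : 0 < min a (1 - a) := lt_min ha.1 ha'
  choose η hη hηgap using fun n : ℕ => exists_gap_lt hF (y := a • y₁ + (1 - a) • y₂)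
    (ε := min a (1 - a) * (1 / 4) ^ n) (by positivity)
  have hboth : ∀ n, F.gap y₁ (η n) ≤ (1 / 4) ^ n ∧ F.gap y₂ (η n) ≤ (1 / 4) ^ n := fun n => by
    have hmix := gap_mix (F := F) y₁ y₂ (η n) a
    rw [h, zero_add] at hmix
    have g1 := gap_nonneg hF h₁ (hη n)
    have g2 := gap_nonneg hF h₂ (hη n)
    have hp : (0 : ℝ) < (1 / 4) ^ n := by positivity
    have hlt := hηgap n
    constructor
    · have : a * F.gap y₁ (η n) ≤ a * (1 / 4) ^ n := by
        have := mul_le_mul_of_nonneg_right (min_le_left a (1 - a)) hp.le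
        have := mul_nonneg ha'.le g2
        linarith
      exact le_of_mul_le_mul_left this ha.1
    · have : (1 - a) * F.gap y₂ (η n) ≤ (1 - a) * (1 / 4) ^ n := by
        have := mul_le_mul_of_nonneg_right (min_le_right a (1 - a)) hp.le
        have := mul_nonneg ha.1.le g1
        linarith
      exact le_of_mul_le_mul_left this ha'
  have hto : ∀ y ∈ F.conjDom, (∀ n, F.gap y (η n) ≤ (1 / 4) ^ n) →
      Filter.Tendsto (fun n => F.gap y (η n)) Filter.atTop (nhds 0) := fun y hy hle =>
    squeeze_zero (fun n => gap_nonneg hF hy (hη n)) hle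
      (tendsto_pow_atTop_nhds_zero_of_lt_one (by norm_num) (by norm_num))
  obtain ⟨S, η', b, hS, hlim⟩ := exists_ae_tendsto_sqrtDensity hF h₁ hη fun n => (hboth n).1
  have hmass := integral_limit_le hF hN hS hlim
  have hlow : ∀ y ∈ F.conjDom, (∀ n, F.gap y (η n) ≤ (1 / 4) ^ n) → ∀ ξ,
      Real.exp (inner ℝ y ξ + b) ≤ ∫ x in S, Real.exp (inner ℝ (F.T x) (η' + ξ)) ∂F.carrier :=
    fun y hy hle ξ => exp_inner_le_integral_limit hF hN hy (hto y hy hle) hS hlim ξ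
  have hexp : ∀ (s : ℝ) (x : X), Real.exp (inner ℝ (F.T x) η' + s * inner ℝ (F.T x) (y₁ - y₂))
      = Real.exp (inner ℝ (F.T x) (η' + s • (y₁ - y₂))) := fun s x => by
    rw [inner_add_right, real_inner_smul_right]
  have key : ∀ y ∈ F.conjDom, (∀ n, F.gap y (η n) ≤ (1 / 4) ^ n) → ∀ᶠ s in nhds (0 : ℝ),
      Real.exp (s * inner ℝ y (y₁ - y₂)) * ∫ x in S, Real.exp (inner ℝ (F.T x) η') ∂F.carrier
        ≤ ∫ x in S, Real.exp (inner ℝ (F.T x) η' + s * inner ℝ (F.T x) (y₁ - y₂)) ∂F.carrier := by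
    refine fun y hy hle => .of_forall fun s => ?_
    simp only [hexp]
    refine (mul_le_mul_of_nonneg_left hmass (Real.exp_nonneg _)).trans ?_
    rw [← Real.exp_add, ← real_inner_smul_right]
    exact hlow y hy hle _
  have hpos : 0 < ∫ x in S, Real.exp (inner ℝ (F.T x) η') ∂F.carrier := by
    have := hlow y₁ h₁ (fun n => (hboth n).1) 0
    rw [add_zero] at this
    exact (Real.exp_pos _).trans_le this
  have heq := eq_of_exp_mul_le_integral (F.measurable_inner_T η')
    (.of_forall fun s => by simpa only [hexp] using (integrable_exp (hmem _)).restrict) hpos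
    (key y₁ h₁ fun n => (hboth n).1) (key y₂ h₂ fun n => (hboth n).2)
  rwa [← sub_eq_zero, ← inner_sub_left, inner_self_eq_zero, sub_eq_zero] at heq

end ExpFamily

/-! ### Posterior weights -/

section Posterior

variable {d : ℕ} {q q₁ q₂ : EuclideanSpace ℝ (Fin d) → ℝ}

lemma IsProbDensity.integrable (hq : IsProbDensity q) : Integrable q := by
  refine ⟨hq.1.aestronglyMeasurable, ?_⟩
  rw [hasFiniteIntegral_iff_ofReal (.of_forall hq.2.1), hq.2.2]
  exact ENNReal.one_lt_top

lemma IsProbDensity.isProbabilityMeasure (hq : IsProbDensity q) :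
    IsProbabilityMeasure (densityMeasure q) :=
  ⟨by rw [densityMeasure, withDensity_apply _ MeasurableSet.univ, setLIntegral_univ, hq.2.2]⟩

lemma lintegral_densityMeasure (hq : IsProbDensity q) {g : EuclideanSpace ℝ (Fin d) → ℝ}
    (hg : Measurable g) :
    ∫⁻ z, ENNReal.ofReal (g z) ∂densityMeasure q = ∫⁻ z, ENNReal.ofReal (q z * g z) := by
  rw [densityMeasure, lintegral_withDensity_eq_lintegral_mul _ hq.1.ennreal_ofReal
    hg.ennreal_ofReal]
  simp only [Pi.mul_apply, ENNReal.ofReal_mul (hq.2.1 _)]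

lemma measurable_posteriorRatio (h₁ : IsProbDensity q₁) (h₂ : IsProbDensity q₂) :
    Measurable (posteriorRatio q₁ q₂) :=
  h₁.1.div (h₁.1.add h₂.1)

lemma posteriorRatio_mem_Icc (h₁ : IsProbDensity q₁) (h₂ : IsProbDensity q₂)
    (z : EuclideanSpace ℝ (Fin d)) : posteriorRatio q₁ q₂ z ∈ Icc (0 : ℝ) 1 :=
  ⟨div_nonneg (h₁.2.1 z) (add_nonneg (h₁.2.1 z) (h₂.2.1 z)),
    div_le_one_of_le₀ (le_add_of_nonneg_right (h₂.2.1 z)) (add_nonneg (h₁.2.1 z) (h₂.2.1 z))⟩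

/-- The identity `q₁ = (q₁ + q₂) α`, which also holds where both densities vanish. -/
lemma add_mul_posteriorRatio (h₁ : IsProbDensity q₁) (h₂ : IsProbDensity q₂)
    (z : EuclideanSpace ℝ (Fin d)) : (q₁ z + q₂ z) * posteriorRatio q₁ q₂ z = q₁ z := by
  rcases eq_or_ne (q₁ z + q₂ z) 0 with h | h
  · rw [h, zero_mul]
    linarith [h₁.2.1 z, h₂.2.1 z]
  · exact mul_div_cancel₀ _ h

lemma add_mul_one_sub_posteriorRatio (h₁ : IsProbDensity q₁) (h₂ : IsProbDensity q₂)
    (z : EuclideanSpace ℝ (Fin d)) : (q₁ z + q₂ z) * (1 - posteriorRatio q₁ q₂ z) = q₂ z := by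
  rw [mul_sub, add_mul_posteriorRatio h₁ h₂]; ring

lemma lintegral_add_mul_const (h₁ : IsProbDensity q₁) (h₂ : IsProbDensity q₂) (c : ℝ) :
    ∫⁻ z, ENNReal.ofReal ((q₁ z + q₂ z) * c) = ENNReal.ofReal (2 * c) := by
  simp only [ENNReal.ofReal_mul (add_nonneg (h₁.2.1 _) (h₂.2.1 _)),
    ENNReal.ofReal_add (h₁.2.1 _) (h₂.2.1 _)]
  have hm : Measurable fun z => ENNReal.ofReal (q₁ z) + ENNReal.ofReal (q₂ z) :=
    h₁.1.ennreal_ofReal.add h₂.1.ennreal_ofReal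
  rw [lintegral_mul_const _ hm,
    lintegral_add_left h₁.1.ennreal_ofReal, h₁.2.2, h₂.2.2, ENNReal.ofReal_mul two_pos.le,
    ENNReal.ofReal_ofNat, one_add_one_eq_two]

end Posterior

/-! ### The two-user objective -/

/-- Subtracting a lower bound turns the extended expectation into a Lebesgue integral. -/
lemma extExpectation_eq {Z : Type*} [MeasurableSpace Z] {μ : Measure Z} [IsProbabilityMeasure μ]
    {f : Z → ℝ} (hf : Measurable f) {c : ℝ} (hc : ∀ z, c ≤ f z) :
    extExpectation μ f = (c : EReal) + ((∫⁻ z, ENNReal.ofReal (f z - c) ∂μ : ℝ≥0∞) : EReal) := by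
  have hneg : ∫⁻ z, ENNReal.ofReal (-f z) ∂μ ≠ ∞ := by
    refine ne_top_of_le_ne_top (ENNReal.ofReal_ne_top (r := -c)) ?_
    calc ∫⁻ z, ENNReal.ofReal (-f z) ∂μ ≤ ∫⁻ _, ENNReal.ofReal (-c) ∂μ :=
          lintegral_mono fun z => ENNReal.ofReal_le_ofReal (neg_le_neg (hc z))
      _ = ENNReal.ofReal (-c) := by simp
  have hsum : ∫⁻ z, ENNReal.ofReal (f z - c) ∂μ + ∫⁻ z, ENNReal.ofReal (-f z) ∂μ
      + ENNReal.ofReal c = ∫⁻ z, ENNReal.ofReal (f z) ∂μ + ENNReal.ofReal (-c) := by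
    have e1 : ENNReal.ofReal c = ∫⁻ _, ENNReal.ofReal c ∂μ := by simp
    have e2 : ENNReal.ofReal (-c) = ∫⁻ _, ENNReal.ofReal (-c) ∂μ := by simp
    have hm : Measurable fun z => ENNReal.ofReal (f z - c) + ENNReal.ofReal (-f z) :=
      (hf.sub_const c).ennreal_ofReal.add hf.neg.ennreal_ofReal
    rw [e1, e2, ← lintegral_add_left (hf.sub_const c).ennreal_ofReal,
      ← lintegral_add_left hm,
      ← lintegral_add_left hf.ennreal_ofReal]
    refine lintegral_congr fun z => ?_
    have h := hc z
    rcases le_total 0 (f z) with h1 | h1 <;> rcases le_total 0 c with h2 | h2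
    · rw [ENNReal.ofReal_of_nonpos (neg_nonpos.2 h1), ENNReal.ofReal_of_nonpos (neg_nonpos.2 h2),
        add_zero, add_zero, ← ENNReal.ofReal_add (sub_nonneg.2 h) h2, sub_add_cancel]
    · rw [ENNReal.ofReal_of_nonpos (neg_nonpos.2 h1), ENNReal.ofReal_of_nonpos h2,
        add_zero, add_zero, ← ENNReal.ofReal_add h1 (neg_nonneg.2 h2), sub_eq_add_neg]
    · have h3 : c = 0 := le_antisymm (h.trans h1) h2
      have h4 : f z = 0 := le_antisymm h1 (h2.trans h)
      simp [h3, h4]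
    · rw [ENNReal.ofReal_of_nonpos h1, ENNReal.ofReal_of_nonpos h2,
        add_zero, zero_add, ← ENNReal.ofReal_add (sub_nonneg.2 h) (neg_nonneg.2 h1)]
      congr 1; ring
  rw [extExpectation]
  set L := ∫⁻ z, ENNReal.ofReal (f z - c) ∂μ
  set P := ∫⁻ z, ENNReal.ofReal (f z) ∂μ
  set N := ∫⁻ z, ENNReal.ofReal (-f z) ∂μ
  clear_value L P N
  have hL : L = ∞ ↔ P = ∞ := by
    constructor <;> intro h
    · have : P + ENNReal.ofReal (-c) = ∞ := by rw [← hsum, h]; simp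
      simpa using this
    · have : L + N + ENNReal.ofReal c = ∞ := by rw [hsum, h]; simp
      simpa [hneg] using this
  by_cases hP : P = ∞
  · rw [hP, hL.2 hP]
    lift N to ℝ≥0 using hneg
    simp only [EReal.coe_ennreal_top, EReal.coe_add_top]
    rw [EReal.coe_nnreal_eq_coe_real, EReal.top_sub_coe]
  · have hLt : L ≠ ∞ := fun h => hP (hL.1 h)
    lift N to ℝ≥0 using hneg
    lift P to ℝ≥0 using hP
    lift L to ℝ≥0 using hLt
    rw [EReal.coe_nnreal_eq_coe_real, EReal.coe_nnreal_eq_coe_real,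
      EReal.coe_nnreal_eq_coe_real, ← EReal.coe_sub, ← EReal.coe_add, EReal.coe_eq_coe_iff]
    have h := congrArg ENNReal.toReal hsum
    rw [ENNReal.toReal_add (by simp) (by simp), ENNReal.toReal_add (by simp) (by simp),
      ENNReal.toReal_add (by simp) (by simp), ENNReal.toReal_ofReal', ENNReal.toReal_ofReal'] at h
    simp only [ENNReal.coe_toReal] at h
    have hmax : max c 0 - max (-c) 0 = c := by
      rcases le_total 0 c with h' | h' <;> simp [h']
    linarith

namespace ExpFamily

variable {X : Type*} [MeasurableSpace X] {k d : ℕ} {F : ExpFamily X k} {x₁ x₂ : X}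
  {q₁ q₂ : EuclideanSpace ℝ (Fin d) → ℝ}

/-- The mixed sufficient statistic `α T(x₁) + (1 - α) T(x₂)`. -/
def mixedT (F : ExpFamily X k) (x₁ x₂ : X) (q₁ q₂ : EuclideanSpace ℝ (Fin d) → ℝ)
    (z : EuclideanSpace ℝ (Fin d)) : EuclideanSpace ℝ (Fin k) :=
  posteriorRatio q₁ q₂ z • F.T x₁ + (1 - posteriorRatio q₁ q₂ z) • F.T x₂

/-- The integrand of the averaged Jensen gap. -/
def weightedGap (F : ExpFamily X k) (x₁ x₂ : X) (q₁ q₂ : EuclideanSpace ℝ (Fin d) → ℝ)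
    (z : EuclideanSpace ℝ (Fin d)) : ℝ :=
  (q₁ z + q₂ z) * jensenGap (convexConjugate F.A) (F.T x₁) (F.T x₂) (posteriorRatio q₁ q₂ z)

lemma measurable_mixedT (h₁ : IsProbDensity q₁) (h₂ : IsProbDensity q₂) :
    Measurable (F.mixedT x₁ x₂ q₁ q₂) :=
  ((measurable_posteriorRatio h₁ h₂).smul_const _).add
    (((measurable_posteriorRatio h₁ h₂).const_sub 1).smul_const _)

lemma measurable_weightedGap (h₁ : IsProbDensity q₁) (h₂ : IsProbDensity q₂) :
    Measurable (F.weightedGap x₁ x₂ q₁ q₂) :=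
  (h₁.1.add h₂.1).mul ((((measurable_posteriorRatio h₁ h₂).mul_const _).add
    (((measurable_posteriorRatio h₁ h₂).const_sub 1).mul_const _)).sub
      (F.measurable_conj.comp (measurable_mixedT h₁ h₂)))

lemma weightedGap_nonneg (hF : F.IsRegular) (hT₁ : F.T x₁ ∈ F.conjDom) (hT₂ : F.T x₂ ∈ F.conjDom)
    (h₁ : IsProbDensity q₁) (h₂ : IsProbDensity q₂) (z : EuclideanSpace ℝ (Fin d)) :
    0 ≤ F.weightedGap x₁ x₂ q₁ q₂ z :=
  mul_nonneg (add_nonneg (h₁.2.1 z) (h₂.2.1 z))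
    (jensenGap_nonneg hF hT₁ hT₂ (posteriorRatio_mem_Icc h₁ h₂ z))

/-- The Jensen gap is bounded on `[0, 1]`, because `A*` is bounded below by an affine function. -/
lemma integrable_weightedGap (hF : F.IsRegular) (hT₁ : F.T x₁ ∈ F.conjDom)
    (hT₂ : F.T x₂ ∈ F.conjDom) (h₁ : IsProbDensity q₁) (h₂ : IsProbDensity q₂) :
    Integrable (F.weightedGap x₁ x₂ q₁ q₂) := by
  obtain ⟨η, hη⟩ := hF.2.1
  refine ((h₁.integrable.add h₂.integrable).mul_const
    (F.gap (F.T x₁) η + F.gap (F.T x₂) η)).mono'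
    (measurable_weightedGap h₁ h₂).aestronglyMeasurable (.of_forall fun z => ?_)
  rw [Real.norm_of_nonneg (weightedGap_nonneg hF hT₁ hT₂ h₁ h₂ z)]
  refine mul_le_mul_of_nonneg_left ?_ (add_nonneg (h₁.2.1 z) (h₂.2.1 z))
  have ha := posteriorRatio_mem_Icc h₁ h₂ z
  have hmix := gap_mix (F := F) (F.T x₁) (F.T x₂) η (posteriorRatio q₁ q₂ z)
  have g0 := gap_nonneg hF (mix_mem_conjDom hF hT₁ hT₂ ha) hη
  have g1 := gap_nonneg hF hT₁ hη
  have g2 := gap_nonneg hF hT₂ hη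
  have m1 := mul_le_mul_of_nonneg_right ha.2 g1
  have m2 := mul_nonneg ha.1 g2
  linarith

lemma neg_log_density {x : X} (hx : 0 < F.h x) (η : EuclideanSpace ℝ (Fin k)) :
    -Real.log (F.density η x) - -(Real.log (F.h x) + F.conj (F.T x)) = F.gap (F.T x) η := by
  rw [density, Real.log_mul hx.ne' (Real.exp_pos _).ne', Real.log_exp, gap, logZ]
  ring

lemma extExpectation_neg_log_density (hF : F.IsRegular) {x : X} (hx : 0 < F.h x)
    (hT : F.T x ∈ F.conjDom) {q : EuclideanSpace ℝ (Fin d) → ℝ} (hq : IsProbDensity q)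
    {η : EuclideanSpace ℝ (Fin d) → EuclideanSpace ℝ (Fin k)} (hη : η ∈ admissibleMaps F d) :
    extExpectation (densityMeasure q) (fun z => -Real.log (F.density (η z) x))
      = ((-(Real.log (F.h x) + F.conj (F.T x)) : ℝ) : EReal)
        + ((∫⁻ z, ENNReal.ofReal (q z * F.gap (F.T x) (η z)) : ℝ≥0∞) : EReal) := by
  have := hq.isProbabilityMeasure
  have hgap : Measurable fun z => F.gap (F.T x) (η z) := measurable_gap measurable_const hη.1
  have hmeas : Measurable fun z => -Real.log (F.density (η z) x) := by
    have h := hgap.add_const (-(Real.log (F.h x) + F.conj (F.T x)))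
    simpa only [← neg_log_density hx, sub_add_cancel] using h
  rw [extExpectation_eq hmeas (c := -(Real.log (F.h x) + F.conj (F.T x))) fun z => by
    have h1 := neg_log_density hx (η z)
    have h2 := gap_nonneg hF hT (hη.2 z)
    linarith]
  simp only [neg_log_density hx]
  rw [lintegral_densityMeasure hq hgap]

/-- The objective exceeds the claimed optimal value exactly by the integral of
`(q₁ + q₂)` times the Fenchel–Young gap of the decoder at the mixed statistic. -/
lemma twoUserObjective_eq (hF : F.IsRegular) (hx₁ : 0 < F.h x₁) (hx₂ : 0 < F.h x₂)
    (hT₁ : F.T x₁ ∈ F.conjDom) (hT₂ : F.T x₂ ∈ F.conjDom)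
    (p : Measure (EuclideanSpace ℝ (Fin d))) (h₁ : IsProbDensity q₁) (h₂ : IsProbDensity q₂)
    (β : ℝ) {η : EuclideanSpace ℝ (Fin d) → EuclideanSpace ℝ (Fin k)}
    (hη : η ∈ admissibleMaps F d) :
    twoUserObjective F x₁ x₂ p q₁ q₂ β η
      = ((-(Real.log (F.h x₁) + F.conj (F.T x₁) + (Real.log (F.h x₂) + F.conj (F.T x₂)))
          + ∫ z, F.weightedGap x₁ x₂ q₁ q₂ z : ℝ) : EReal) + klTerm p q₁ q₂ β
        + ((∫⁻ z, ENNReal.ofReal ((q₁ z + q₂ z) * F.gap (F.mixedT x₁ x₂ q₁ q₂ z) (η z))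
            : ℝ≥0∞) : EReal) := by
  have hg₁ : Measurable fun z => F.gap (F.T x₁) (η z) := measurable_gap measurable_const hη.1
  have hm₁ : Measurable fun z => ENNReal.ofReal (q₁ z * F.gap (F.T x₁) (η z)) :=
    (h₁.1.mul hg₁).ennreal_ofReal
  have hsum : (∫⁻ z, ENNReal.ofReal (q₁ z * F.gap (F.T x₁) (η z)))
      + ∫⁻ z, ENNReal.ofReal (q₂ z * F.gap (F.T x₂) (η z))
      = ENNReal.ofReal (∫ z, F.weightedGap x₁ x₂ q₁ q₂ z)
        + ∫⁻ z, ENNReal.ofReal ((q₁ z + q₂ z) * F.gap (F.mixedT x₁ x₂ q₁ q₂ z) (η z)) := by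
    rw [ofReal_integral_eq_lintegral_ofReal (integrable_weightedGap hF hT₁ hT₂ h₁ h₂)
      (.of_forall (weightedGap_nonneg hF hT₁ hT₂ h₁ h₂)),
      ← lintegral_add_left hm₁,
      ← lintegral_add_left (measurable_weightedGap h₁ h₂).ennreal_ofReal]
    refine lintegral_congr fun z => ?_
    have ha := posteriorRatio_mem_Icc h₁ h₂ z
    rw [← ENNReal.ofReal_add (mul_nonneg (h₁.2.1 z) (gap_nonneg hF hT₁ (hη.2 z)))
        (mul_nonneg (h₂.2.1 z) (gap_nonneg hF hT₂ (hη.2 z))),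
      ← ENNReal.ofReal_add (weightedGap_nonneg hF hT₁ hT₂ h₁ h₂ z)
        (mul_nonneg (add_nonneg (h₁.2.1 z) (h₂.2.1 z))
          (gap_nonneg (y := F.mixedT x₁ x₂ q₁ q₂ z) hF
            (mix_mem_conjDom hF hT₁ hT₂ ha) (hη.2 z))),
      weightedGap, ← mul_add, mixedT, ← gap_mix, mul_add, ← mul_assoc, ← mul_assoc,
      add_mul_posteriorRatio h₁ h₂, add_mul_one_sub_posteriorRatio h₁ h₂]
  have hI : 0 ≤ ∫ z, F.weightedGap x₁ x₂ q₁ q₂ z :=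
    integral_nonneg (weightedGap_nonneg hF hT₁ hT₂ h₁ h₂)
  rw [twoUserObjective, extExpectation_neg_log_density hF hx₁ hT₁ h₁ hη,
    extExpectation_neg_log_density hF hx₂ hT₂ h₂ hη, add_add_add_comm, ← EReal.coe_ennreal_add,
    hsum, EReal.coe_ennreal_add, EReal.coe_ennreal_ofReal, max_eq_left hI, ← EReal.coe_add,
    ← add_assoc, ← EReal.coe_add, ← neg_add, add_right_comm]

lemma isGLB_twoUserObjective (hF : F.IsRegular) (hx₁ : 0 < F.h x₁) (hx₂ : 0 < F.h x₂)
    (hT₁ : F.T x₁ ∈ F.conjDom) (hT₂ : F.T x₂ ∈ F.conjDom)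
    (p : Measure (EuclideanSpace ℝ (Fin d))) (h₁ : IsProbDensity q₁) (h₂ : IsProbDensity q₂)
    (β : ℝ) :
    IsGLB (twoUserObjective F x₁ x₂ p q₁ q₂ β '' admissibleMaps F d)
      (((-(Real.log (F.h x₁) + F.conj (F.T x₁) + (Real.log (F.h x₂) + F.conj (F.T x₂)))
          + ∫ z, F.weightedGap x₁ x₂ q₁ q₂ z : ℝ) : EReal) + klTerm p q₁ q₂ β) := by
  constructor
  · rintro _ ⟨η, hη, rfl⟩
    rw [twoUserObjective_eq hF hx₁ hx₂ hT₁ hT₂ p h₁ h₂ β hη]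
    exact le_add_of_nonneg_right (EReal.coe_ennreal_nonneg _)
  · intro b hb
    set V : EReal :=
      ((-(Real.log (F.h x₁) + F.conj (F.T x₁) + (Real.log (F.h x₂) + F.conj (F.T x₂)))
          + ∫ z, F.weightedGap x₁ x₂ q₁ q₂ z : ℝ) : EReal) + klTerm p q₁ q₂ β with hV
    have hle : ∀ ε : ℝ, 0 < ε → b ≤ V + (ε : EReal) := fun ε hε => by
      obtain ⟨η, hηm, hη⟩ := exists_measurable_gap_lt hF
        (measurable_mixedT (F := F) (x₁ := x₁) (x₂ := x₂) h₁ h₂) (half_pos hε)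
      have hadm : η ∈ admissibleMaps F d := ⟨hηm, fun z => (hη z).1⟩
      have hbound : ∫⁻ z, ENNReal.ofReal ((q₁ z + q₂ z) * F.gap (F.mixedT x₁ x₂ q₁ q₂ z) (η z))
          ≤ ENNReal.ofReal ε := by
        calc _ ≤ ∫⁻ z, ENNReal.ofReal ((q₁ z + q₂ z) * (ε / 2)) :=
              lintegral_mono fun z => ENNReal.ofReal_le_ofReal
                (mul_le_mul_of_nonneg_left (hη z).2.le (add_nonneg (h₁.2.1 z) (h₂.2.1 z)))
          _ = ENNReal.ofReal ε := by
              rw [lintegral_add_mul_const h₁ h₂, mul_div_cancel₀ _ two_ne_zero]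
      refine (hb (mem_image_of_mem _ hadm)).trans ?_
      rw [twoUserObjective_eq hF hx₁ hx₂ hT₁ hT₂ p h₁ h₂ β hadm, ← hV]
      refine add_le_add_right ?_ V
      have := EReal.coe_ennreal_le_coe_ennreal_iff.2 hbound
      rwa [EReal.coe_ennreal_ofReal, max_eq_left hε.le] at this
    clear_value V
    induction V with
    | top => exact le_top
    | bot => simpa using hle 1 one_pos
    | coe v =>
      refine EReal.le_of_forall_lt_iff_le.1 fun w hw => ?_
      have hvw : 0 < w - v := sub_pos.2 (EReal.coe_lt_coe_iff.1 hw)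
      have := hle _ hvw
      rwa [← EReal.coe_add, add_sub_cancel] at this

lemma isLeast_twoUserObjective (hF : F.IsRegular) (hx₁ : 0 < F.h x₁) (hx₂ : 0 < F.h x₂)
    (hT₁ : F.T x₁ ∈ F.conjDom) (hT₂ : F.T x₂ ∈ F.conjDom)
    (p : Measure (EuclideanSpace ℝ (Fin d))) (h₁ : IsProbDensity q₁) (h₂ : IsProbDensity q₂)
    (β : ℝ)
    (hint : ∀ᵐ z, 0 < q₁ z + q₂ z → F.mixedT x₁ x₂ q₁ q₂ z ∈ interior F.conjDom) :
    IsLeast (twoUserObjective F x₁ x₂ p q₁ q₂ β '' admissibleMaps F d)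
      (((-(Real.log (F.h x₁) + F.conj (F.T x₁) + (Real.log (F.h x₂) + F.conj (F.T x₂)))
          + ∫ z, F.weightedGap x₁ x₂ q₁ q₂ z : ℝ) : EReal) + klTerm p q₁ q₂ β) := by
  refine ⟨?_, (isGLB_twoUserObjective hF hx₁ hx₂ hT₁ hT₂ p h₁ h₂ β).1⟩
  obtain ⟨η, hηm, hη⟩ := exists_measurable_gap_eq_zero hF
    (measurable_mixedT (F := F) (x₁ := x₁) (x₂ := x₂) h₁ h₂)
  have hadm : η ∈ admissibleMaps F d := ⟨hηm, fun z => (hη z).1⟩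
  refine ⟨η, hadm, ?_⟩
  have hzero : ∫⁻ z, ENNReal.ofReal ((q₁ z + q₂ z) * F.gap (F.mixedT x₁ x₂ q₁ q₂ z) (η z)) = 0 :=
    lintegral_eq_zero_of_ae_eq_zero <| hint.mono fun z hz => by
      rcases (add_nonneg (h₁.2.1 z) (h₂.2.1 z)).eq_or_lt with h | h
      · simp [← h]
      · simp [(hη z).2 (hz h)]
  rw [twoUserObjective_eq hF hx₁ hx₂ hT₁ hT₂ p h₁ h₂ β hadm, hzero, EReal.coe_ennreal_zero,
    add_zero]

/-! ### When the averaged gap vanishes -/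

lemma jensenGap_eq_zero_of_trivial {y₁ y₂ : EuclideanSpace ℝ (Fin k)} {a : ℝ}
    (h : a = 0 ∨ a = 1 ∨ y₁ = y₂) : jensenGap (convexConjugate F.A) y₁ y₂ a = 0 := by
  rcases h with rfl | rfl | rfl
  · simp [jensenGap]
  · simp [jensenGap]
  · rw [jensenGap, ← add_smul, ← add_mul, add_sub_cancel, one_smul, one_mul, sub_self]

lemma mul_eq_zero_iff_posteriorRatio (h₁ : IsProbDensity q₁) (h₂ : IsProbDensity q₂)
    (z : EuclideanSpace ℝ (Fin d)) : q₁ z * q₂ z = 0 ↔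
      q₁ z + q₂ z = 0 ∨ posteriorRatio q₁ q₂ z = 0 ∨ posteriorRatio q₁ q₂ z = 1 := by
  have e1 := add_mul_posteriorRatio h₁ h₂ z
  have e2 := add_mul_one_sub_posteriorRatio h₁ h₂ z
  constructor
  · intro h
    rcases mul_eq_zero.1 h with h | h
    · rw [h] at e1
      rcases mul_eq_zero.1 e1 with h' | h'
      · exact Or.inl (by rw [h, h'])
      · exact Or.inr (Or.inl h')
    · rw [h] at e2
      rcases mul_eq_zero.1 e2 with h' | h'
      · exact Or.inl (by rw [h, h'])
      · exact Or.inr (Or.inr (sub_eq_zero.1 h').symm)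
  · rintro (h | h | h)
    · rw [← e1, h, zero_mul, zero_mul]
    · rw [← e1, h, mul_zero, zero_mul]
    · rw [← e2, h, sub_self, mul_zero, mul_zero]

lemma integral_weightedGap_eq_zero (h₁ : IsProbDensity q₁) (h₂ : IsProbDensity q₂)
    (h : (∀ᵐ z, q₁ z * q₂ z = 0) ∨ F.T x₁ = F.T x₂) :
    ∫ z, F.weightedGap x₁ x₂ q₁ q₂ z = 0 := by
  refine integral_eq_zero_of_ae ?_
  rcases h with h | h
  · filter_upwards [h] with z hz
    rcases (mul_eq_zero_iff_posteriorRatio h₁ h₂ z).1 hz with h' | h'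
    · simp [weightedGap, h']
    · simp [weightedGap,
        jensenGap_eq_zero_of_trivial (F := F) (h'.imp_right (Or.inl (b := F.T x₁ = F.T x₂)))]
  · exact .of_forall fun z => by
      simp [weightedGap, jensenGap_eq_zero_of_trivial (F := F) (Or.inr (Or.inr h))]

lemma jensenGap_eq_zero_iff (hF : F.IsRegular) {y₁ y₂ : EuclideanSpace ℝ (Fin k)}
    (h₁ : y₁ ∈ F.conjDom) (h₂ : y₂ ∈ F.conjDom)
    (h : F.naturalSpace = univ ∨ ∃ a ∈ Ioo (0 : ℝ) 1,
      a • y₁ + (1 - a) • y₂ ∈ interior F.conjDom) {a : ℝ} (ha : a ∈ Icc (0 : ℝ) 1) :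
    jensenGap (convexConjugate F.A) y₁ y₂ a = 0 ↔ a = 0 ∨ a = 1 ∨ y₁ = y₂ := by
  refine ⟨fun h0 => ?_, jensenGap_eq_zero_of_trivial⟩
  rcases ha.1.eq_or_lt with rfl | ha0
  · exact Or.inl rfl
  rcases ha.2.eq_or_lt with rfl | ha1
  · exact Or.inr (Or.inl rfl)
  refine Or.inr (Or.inr ?_)
  rcases h with hN | ⟨b, hb, hint⟩
  · exact eq_of_jensenGap_eq_zero_of_univ hF hN h₁ h₂ ⟨ha0, ha1⟩ h0
  · exact eq_of_jensenGap_eq_zero_of_interior hF h₁ h₂ hb hint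
      (jensenGap_eq_zero_of_eq_zero hF h₁ h₂ ⟨ha0, ha1⟩ hb h0)

lemma integral_weightedGap_eq_zero_iff (hF : F.IsRegular) (hT₁ : F.T x₁ ∈ F.conjDom)
    (hT₂ : F.T x₂ ∈ F.conjDom) (h₁ : IsProbDensity q₁) (h₂ : IsProbDensity q₂)
    (h : F.naturalSpace = univ ∨ ∃ a ∈ Ioo (0 : ℝ) 1,
      a • F.T x₁ + (1 - a) • F.T x₂ ∈ interior F.conjDom) :
    ∫ z, F.weightedGap x₁ x₂ q₁ q₂ z = 0 ↔ (∀ᵐ z, q₁ z * q₂ z = 0) ∨ F.T x₁ = F.T x₂ := by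
  refine ⟨fun h0 => ?_, integral_weightedGap_eq_zero h₁ h₂⟩
  rw [integral_eq_zero_iff_of_nonneg (weightedGap_nonneg hF hT₁ hT₂ h₁ h₂)
    (integrable_weightedGap hF hT₁ hT₂ h₁ h₂)] at h0
  by_cases hT : F.T x₁ = F.T x₂
  · exact Or.inr hT
  refine Or.inl (h0.mono fun z hz => (mul_eq_zero_iff_posteriorRatio h₁ h₂ z).2 ?_)
  refine (mul_eq_zero.1 hz).imp_right fun hz => ?_
  have := (jensenGap_eq_zero_iff hF hT₁ hT₂ h (posteriorRatio_mem_Icc h₁ h₂ z)).1 hz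
  simpa [hT] using this

end ExpFamily

/-! ### The Wasserstein distance as a pseudometric -/

section Wasserstein

variable {d : ℕ} {μ ν ρ : Measure (EuclideanSpace ℝ (Fin d))}

lemma wasserstein1_le {π : Measure (EuclideanSpace ℝ (Fin d) × EuclideanSpace ℝ (Fin d))}
    (h₁ : π.map Prod.fst = μ) (h₂ : π.map Prod.snd = ν) :
    wasserstein1 μ ν ≤ ∫⁻ w, edist w.1 w.2 ∂π :=
  iInf₂_le_of_le π ⟨h₁, h₂⟩ le_rfl

lemma wasserstein1_symm_le (μ ν : Measure (EuclideanSpace ℝ (Fin d))) :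
    wasserstein1 μ ν ≤ wasserstein1 ν μ := by
  refine le_iInf₂ fun π hπ => ?_
  calc wasserstein1 μ ν ≤ ∫⁻ w, edist w.1 w.2 ∂(π.map Prod.swap) := by
        refine wasserstein1_le ?_ ?_
        · rw [Measure.map_map measurable_fst measurable_swap]; exact hπ.2
        · rw [Measure.map_map measurable_snd measurable_swap]; exact hπ.1
    _ = ∫⁻ w, edist w.1 w.2 ∂π := by
        rw [lintegral_map measurable_edist measurable_swap]
        simp only [Prod.fst_swap, Prod.snd_swap, edist_comm]

/-- Couplings of `(μ, ρ)` and `(ρ, ν)` are glued along the disintegrations over `ρ`. -/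
lemma wasserstein1_triangle [IsProbabilityMeasure ρ] :
    wasserstein1 μ ν ≤ wasserstein1 μ ρ + wasserstein1 ρ ν := by
  refine (le_trans ?_ (add_le_add_left (wasserstein1_symm_le ρ μ) _))
  refine ENNReal.le_iInf₂_add_iInf₂ fun π₁ h₁ π₂ h₂ => ?_
  have hfin : ∀ π : Measure (EuclideanSpace ℝ (Fin d) × EuclideanSpace ℝ (Fin d)),
      π.map Prod.fst = ρ → IsFiniteMeasure π := fun π h => ⟨by
    have := congrArg (fun m => m univ) h
    simp only [Measure.map_apply measurable_fst MeasurableSet.univ, preimage_univ,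
      measure_univ] at this
    rw [this]; exact ENNReal.one_lt_top⟩
  have := hfin π₁ h₁.1
  have := hfin π₂ h₂.1
  set γ := ρ ⊗ₘ (π₁.condKernel ×ₖ π₂.condKernel) with hγ
  have e₁ : γ.map (Prod.map id Prod.fst) = π₁ := by
    rw [hγ, ← Measure.compProd_map measurable_fst, ← Kernel.fst_eq, Kernel.fst_prod,
      ← h₁.1]
    exact π₁.disintegrate π₁.condKernel
  have e₂ : γ.map (Prod.map id Prod.snd) = π₂ := by
    rw [hγ, ← Measure.compProd_map measurable_snd, ← Kernel.snd_eq, Kernel.snd_prod,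
      ← h₂.1]
    exact π₂.disintegrate π₂.condKernel
  have m₁ : Measurable (Prod.map (id : EuclideanSpace ℝ (Fin d) → _)
      (Prod.fst : EuclideanSpace ℝ (Fin d) × EuclideanSpace ℝ (Fin d) → _)) :=
    measurable_id.prodMap measurable_fst
  have m₂ : Measurable (Prod.map (id : EuclideanSpace ℝ (Fin d) → _)
      (Prod.snd : EuclideanSpace ℝ (Fin d) × EuclideanSpace ℝ (Fin d) → _)) :=
    measurable_id.prodMap measurable_snd
  have m₃ : Measurable fun w : EuclideanSpace ℝ (Fin d) × EuclideanSpace ℝ (Fin d)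
      × EuclideanSpace ℝ (Fin d) => edist w.1 w.2.1 := measurable_edist.comp m₁
  calc wasserstein1 μ ν ≤ ∫⁻ w, edist w.1 w.2 ∂(γ.map Prod.snd) := by
        refine wasserstein1_le ?_ ?_
        · rw [Measure.map_map measurable_fst measurable_snd, ← h₁.2, ← e₁,
            Measure.map_map measurable_snd m₁]
          rfl
        · rw [Measure.map_map measurable_snd measurable_snd, ← h₂.2, ← e₂,
            Measure.map_map measurable_snd m₂]
          rfl
    _ = ∫⁻ w, edist w.2.1 w.2.2 ∂γ := lintegral_map measurable_edist measurable_snd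
    _ ≤ ∫⁻ w, (edist w.1 w.2.1 + edist w.1 w.2.2) ∂γ :=
        lintegral_mono fun w => edist_triangle_left _ _ _
    _ = ∫⁻ w, edist w.1 w.2 ∂π₁ + ∫⁻ w, edist w.1 w.2 ∂π₂ := by
        rw [lintegral_add_left m₃]
        conv_rhs => rw [← e₁, ← e₂, lintegral_map measurable_edist m₁,
          lintegral_map measurable_edist m₂]
        rfl

lemma wasserstein1_map_le {g : EuclideanSpace ℝ (Fin d) → EuclideanSpace ℝ (Fin d)}
    (hg : Measurable g) : wasserstein1 μ (μ.map g) ≤ ∫⁻ z, edist z (g z) ∂μ := by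
  have hm : Measurable fun z => (z, g z) := measurable_id.prodMk hg
  refine (wasserstein1_le (π := μ.map fun z => (z, g z)) ?_ ?_).trans_eq
    (lintegral_map measurable_edist hm)
  · rw [Measure.map_map measurable_fst hm]; exact Measure.map_id
  · rw [Measure.map_map measurable_snd hm]; rfl

end Wasserstein

/-! ### Kantorovich–Rubinstein duality -/

/-- Finite transport duality. The set of (marginals, cost) of all plans of mass one is compact and
convex; if it missed `{(a, b)} × (-∞, D]`, a separating functional would give dual potentials, whose
`c`-transform is a `1`-Lipschitz function violating the bound `D`. -/
lemma exists_transport_plan {E ι : Type*} [PseudoMetricSpace E] [Fintype ι] [DecidableEq ι]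
    (z : ι → E) {a b : ι → ℝ} (ha : ∀ i, 0 ≤ a i) (hb : ∀ i, 0 ≤ b i) (ha1 : ∑ i, a i = 1)
    (hb1 : ∑ i, b i = 1) {D : ℝ}
    (hD : ∀ f : E → ℝ, LipschitzWith 1 f → ∑ i, f (z i) * a i - ∑ i, f (z i) * b i ≤ D) :
    ∃ w : ι × ι → ℝ, (∀ ij, 0 ≤ w ij) ∧ (∀ i, ∑ j, w (i, j) = a i) ∧ (∀ j, ∑ i, w (i, j) = b j) ∧
      ∑ ij, w ij * dist (z ij.1) (z ij.2) ≤ D := by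
  let M : (ι × ι → ℝ) →ₗ[ℝ] (ι → ℝ) × (ι → ℝ) × ℝ :=
    { toFun := fun w => (fun i => ∑ j, w (i, j), fun j => ∑ i, w (i, j),
        ∑ ij, w ij * dist (z ij.1) (z ij.2))
      map_add' := fun v w => by
        ext <;> simp [Finset.sum_add_distrib, add_mul]
      map_smul' := fun c w => by
        ext <;> simp [Finset.mul_sum, mul_assoc] }
  have hMc : Continuous M := M.continuous_of_finiteDimensional
  by_contra hno
  have hdisj : Disjoint (M '' stdSimplex ℝ (ι × ι)) ({a} ×ˢ ({b} ×ˢ Iic D)) := by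
    rw [Set.disjoint_left]
    rintro _ ⟨w, hw, rfl⟩ ⟨h1, h2, h3⟩
    exact hno ⟨w, hw.1, fun i => congrFun h1 i, fun j => congrFun h2 j, h3⟩
  obtain ⟨F, u, v, hFu, huv, hvF⟩ := geometric_hahn_banach_compact_closed
    ((convex_stdSimplex ℝ (ι × ι)).linear_image M) ((isCompact_stdSimplex ℝ (ι × ι)).image hMc)
    ((convex_singleton a).prod ((convex_singleton b).prod (convex_Iic D)))
    (isClosed_singleton.prod (isClosed_singleton.prod isClosed_Iic)) hdisj
  set φ : ι → ℝ := fun i => F (Pi.single i 1, 0, 0) with hφ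
  set ψ : ι → ℝ := fun j => F (0, Pi.single j 1, 0) with hψ
  set l : ℝ := F (0, 0, 1) with hl
  have hF : ∀ (x y : ι → ℝ) (c : ℝ), F (x, y, c) = ∑ i, φ i * x i + ∑ j, ψ j * y j + l * c := by
    intro x y c
    have h1 : F (x, 0, 0) = ∑ i, φ i * x i := by
      have hx : ((x, 0, 0) : (ι → ℝ) × (ι → ℝ) × ℝ)
          = ∑ i, x i • ((Pi.single i 1, 0, 0) : (ι → ℝ) × (ι → ℝ) × ℝ) := by
        ext i <;> simp [Prod.fst_sum, Prod.snd_sum, Finset.sum_apply, Pi.single_apply]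
      rw [hx, map_sum]
      exact Finset.sum_congr rfl fun i _ => by rw [map_smul, smul_eq_mul, mul_comm]
    have h2 : F (0, y, 0) = ∑ j, ψ j * y j := by
      have hy : ((0, y, 0) : (ι → ℝ) × (ι → ℝ) × ℝ)
          = ∑ i, y i • ((0, Pi.single i 1, 0) : (ι → ℝ) × (ι → ℝ) × ℝ) := by
        ext i <;> simp [Prod.fst_sum, Prod.snd_sum, Finset.sum_apply, Pi.single_apply]
      rw [hy, map_sum]
      exact Finset.sum_congr rfl fun i _ => by rw [map_smul, smul_eq_mul, mul_comm]
    have h3 : F (0, 0, c) = l * c := by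
      have hc : ((0, 0, c) : (ι → ℝ) × (ι → ℝ) × ℝ) = c • (0, 0, 1) := by ext <;> simp
      rw [hc, map_smul, smul_eq_mul, mul_comm]
    have hsum : ((x, y, c) : (ι → ℝ) × (ι → ℝ) × ℝ) = (x, 0, 0) + (0, y, 0) + (0, 0, c) := by
      ext <;> simp
    rw [hsum, map_add, map_add, h1, h2, h3]
  have hR : ∀ r ≤ D, v < ∑ i, φ i * a i + ∑ j, ψ j * b j + l * r := fun r hr => by
    rw [← hF]; exact hvF _ ⟨rfl, rfl, hr⟩
  -- The point masses on `ι × ι` are plans, which gives the dual constraints.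
  have hQ : ∀ i j, φ i + ψ j + l * dist (z i) (z j) < u := fun i j => by
    have h := hFu _ (mem_image_of_mem M (single_mem_stdSimplex ℝ (i, j)))
    change F (_, _, _) < u at h
    rw [hF] at h
    simpa [Pi.single_apply, Prod.ext_iff, ite_and, Fintype.sum_prod_type] using h
  -- The product plan has the right marginals, so the multiplier of the cost is negative.
  have hl0 : l < 0 := by
    have hprod : (fun ij : ι × ι => a ij.1 * b ij.2) ∈ stdSimplex ℝ (ι × ι) := by
      refine ⟨fun ij => mul_nonneg (ha _) (hb _), ?_⟩
      rw [Fintype.sum_prod_type]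
      simp only [← Finset.mul_sum, hb1, mul_one, ha1]
    have h := hFu _ (mem_image_of_mem M hprod)
    change F (_, _, _) < u at h
    rw [hF] at h
    simp only [← Finset.mul_sum, ← Finset.sum_mul, hb1, ha1, mul_one, one_mul] at h
    set c₀ : ℝ := ∑ ij : ι × ι, a ij.1 * b ij.2 * dist (z ij.1) (z ij.2)
    by_contra hge
    have h1 := hR (min D c₀) (min_le_left _ _)
    have h2 := mul_le_mul_of_nonneg_left (min_le_right D c₀) (not_lt.1 hge)
    linarith
  have hne : (Finset.univ : Finset ι).Nonempty := by
    by_contra hempty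
    rw [Finset.not_nonempty_iff_eq_empty.1 hempty, Finset.sum_empty] at ha1
    exact zero_ne_one ha1
  set f : E → ℝ := fun x => Finset.univ.inf' hne fun j => dist x (z j) - (ψ j - u) / (-l) with hf
  have hlip : LipschitzWith 1 f := LipschitzWith.of_le_add fun x y => by
    obtain ⟨j, -, hj⟩ := Finset.exists_mem_eq_inf' hne fun j => dist y (z j) - (ψ j - u) / (-l)
    have h1 : f x ≤ dist x (z j) - (ψ j - u) / (-l) := Finset.inf'_le _ (Finset.mem_univ j)
    have h2 : f y = dist y (z j) - (ψ j - u) / (-l) := hj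
    have h3 := dist_triangle x y (z j)
    linarith
  have hlneg : 0 < -l := neg_pos.2 hl0
  have hfφ : ∀ i, φ i / (-l) ≤ f (z i) := fun i => by
    refine Finset.le_inf' hne _ fun j _ => ?_
    rw [le_sub_iff_add_le, ← add_div, div_le_iff₀ hlneg]
    linarith [hQ i j]
  have hfψ : ∀ j, f (z j) ≤ -((ψ j - u) / (-l)) := fun j => by
    refine (Finset.inf'_le _ (Finset.mem_univ j)).trans ?_
    rw [dist_self, zero_sub]
  have h1 : (∑ i, φ i * a i) / (-l) ≤ ∑ i, f (z i) * a i := by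
    rw [Finset.sum_div]
    refine Finset.sum_le_sum fun i _ => ?_
    rw [mul_div_right_comm]
    exact mul_le_mul_of_nonneg_right (hfφ i) (ha i)
  have h2 : ∑ j, f (z j) * b j ≤ -((∑ j, ψ j * b j - u) / (-l)) := by
    calc ∑ j, f (z j) * b j ≤ ∑ j, -((ψ j - u) / (-l)) * b j :=
          Finset.sum_le_sum fun j _ => mul_le_mul_of_nonneg_right (hfψ j) (hb j)
      _ = -((∑ j, (ψ j * b j - u * b j)) / (-l)) := by
          rw [Finset.sum_div, ← Finset.sum_neg_distrib]
          exact Finset.sum_congr rfl fun j _ => by ring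
      _ = -((∑ j, ψ j * b j - u) / (-l)) := by
          rw [Finset.sum_sub_distrib, ← Finset.mul_sum, hb1, mul_one]
  have h3 := hR D le_rfl
  have h4 : D < (∑ i, φ i * a i) / (-l) + (∑ j, ψ j * b j - u) / (-l) := by
    rw [← add_div, lt_div_iff₀ hlneg]
    linarith
  linarith [hD f hlip]

/-- The image of a measure under a simple function is a finite combination of point masses. -/
lemma map_simpleFunc_eq_sum {α β : Type*} [MeasurableSpace α] [MeasurableSpace β]
    (μ : Measure α) (g : SimpleFunc α β) (hg : Measurable g) :
    μ.map g = ∑ i : g.range, μ (g ⁻¹' {(i : β)}) • Measure.dirac (i : β) := by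
  ext s hs
  rw [Measure.map_apply hg hs, Measure.finsetSum_apply]
  have h1 : μ (g ⁻¹' s) = ∫⁻ x, s.indicator (fun _ => (1 : ℝ≥0∞)) (g x) ∂μ := by
    rw [← lintegral_indicator_one (hg hs)]; rfl
  have h2 := (g.map (s.indicator fun _ => (1 : ℝ≥0∞))).lintegral_eq_lintegral μ
  rw [SimpleFunc.map_lintegral] at h2
  rw [h1]
  refine h2.trans ?_
  rw [← Finset.sum_coe_sort g.range]
  refine Finset.sum_congr rfl fun i _ => ?_
  rw [Measure.smul_apply, Measure.dirac_apply' _ hs, smul_eq_mul, mul_comm]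
  rfl

section Duality

variable {d : ℕ} {μ ν : Measure (EuclideanSpace ℝ (Fin d))}

lemma wasserstein1_map_simpleFunc_le [IsProbabilityMeasure μ] [IsProbabilityMeasure ν]
    (g : SimpleFunc (EuclideanSpace ℝ (Fin d)) (EuclideanSpace ℝ (Fin d))) {D : ℝ}
    (hD : ∀ f : EuclideanSpace ℝ (Fin d) → ℝ, LipschitzWith 1 f →
      ∫ z, f (g z) ∂μ - ∫ z, f (g z) ∂ν ≤ D) :
    wasserstein1 (μ.map g) (ν.map g) ≤ ENNReal.ofReal D := by
  classical
  have hmass : ∀ (m : Measure (EuclideanSpace ℝ (Fin d))) [IsProbabilityMeasure m],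
      ∑ i : g.range, m.real (g ⁻¹' {(i : EuclideanSpace ℝ (Fin d))}) = 1 := by
    intro m _
    have h := congrArg (fun r => r.real univ) (map_simpleFunc_eq_sum m g g.measurable)
    have hp := Measure.isProbabilityMeasure_map (μ := m) g.measurable.aemeasurable
    simp only [measureReal_def, Measure.finsetSum_apply, Measure.smul_apply, measure_univ,
      smul_eq_mul, mul_one] at h
    rw [ENNReal.toReal_one, ENNReal.toReal_sum fun i _ => measure_ne_top _ _] at h
    exact h.symm
  have hint : ∀ (m : Measure (EuclideanSpace ℝ (Fin d))) [IsProbabilityMeasure m]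
      (f : EuclideanSpace ℝ (Fin d) → ℝ), Continuous f → ∫ z, f (g z) ∂m
        = ∑ i : g.range, f i * m.real (g ⁻¹' {(i : EuclideanSpace ℝ (Fin d))}) := by
    intro m _ f hf
    rw [← integral_map g.measurable.aemeasurable hf.aestronglyMeasurable,
      map_simpleFunc_eq_sum m g g.measurable, integral_finsetSum_measure]
    · refine Finset.sum_congr rfl fun i _ => ?_
      rw [integral_smul_measure, integral_dirac, smul_eq_mul, mul_comm, measureReal_def]
    · intro i _
      exact (integrable_dirac (by simp)).smul_measure (measure_ne_top _ _)
  obtain ⟨w, hw0, hw1, hw2, hwD⟩ := exists_transport_plan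
    (fun i : g.range => (i : EuclideanSpace ℝ (Fin d)))
    (a := fun i => μ.real (g ⁻¹' {(i : EuclideanSpace ℝ (Fin d))}))
    (b := fun i => ν.real (g ⁻¹' {(i : EuclideanSpace ℝ (Fin d))}))
    (fun _ => measureReal_nonneg) (fun _ => measureReal_nonneg) (hmass μ) (hmass ν) (D := D)
    (fun f hf => by rw [← hint μ f hf.continuous, ← hint ν f hf.continuous]; exact hD f hf)
  have hw1' : ∀ i, ∑ j, ENNReal.ofReal (w (i, j))
      = μ (g ⁻¹' {(i : EuclideanSpace ℝ (Fin d))}) := fun i => by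
    rw [← ENNReal.ofReal_sum_of_nonneg fun j _ => hw0 _, hw1, ofReal_measureReal]
  have hw2' : ∀ j, ∑ i, ENNReal.ofReal (w (i, j))
      = ν (g ⁻¹' {(j : EuclideanSpace ℝ (Fin d))}) := fun j => by
    rw [← ENNReal.ofReal_sum_of_nonneg fun j _ => hw0 _, hw2, ofReal_measureReal]
  refine (wasserstein1_le (π := ∑ ij : g.range × g.range, ENNReal.ofReal (w ij) •
    Measure.dirac ((ij.1 : EuclideanSpace ℝ (Fin d)), (ij.2 : EuclideanSpace ℝ (Fin d))))
    ?_ ?_).trans ?_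
  · rw [map_simpleFunc_eq_sum μ g g.measurable, Measure.map_finset_sum' measurable_fst.aemeasurable,
      Fintype.sum_prod_type]
    refine Finset.sum_congr rfl fun i _ => ?_
    simp only [Measure.map_smul, Measure.map_dirac' measurable_fst, ← Finset.sum_smul, hw1']
  · rw [map_simpleFunc_eq_sum ν g g.measurable, Measure.map_finset_sum' measurable_snd.aemeasurable,
      Fintype.sum_prod_type_right]
    refine Finset.sum_congr rfl fun i _ => ?_
    simp only [Measure.map_smul, Measure.map_dirac' measurable_snd, ← Finset.sum_smul, hw2']
  · rw [lintegral_finsetSum_measure]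
    simp only [lintegral_smul_measure, lintegral_dirac' _ measurable_edist, smul_eq_mul]
    simp only [edist_dist, ← ENNReal.ofReal_mul (hw0 _)]
    rw [← ENNReal.ofReal_sum_of_nonneg fun ij _ => mul_nonneg (hw0 _) dist_nonneg]
    exact ENNReal.ofReal_le_ofReal hwD

/-- Kantorovich–Rubinstein duality on `ℝ^d`, for probability measures with finite first moment.
Both measures are first pushed forward to a common finite set. -/
lemma wasserstein1_le_of_lipschitz [IsProbabilityMeasure μ] [IsProbabilityMeasure ν]
    (hμ : Integrable (fun z => z) μ) (hν : Integrable (fun z => z) ν)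
    {D : ℝ} (hD : ∀ f : EuclideanSpace ℝ (Fin d) → ℝ, LipschitzWith 1 f →
      ∫ z, f z ∂μ - ∫ z, f z ∂ν ≤ D) :
    wasserstein1 μ ν ≤ ENNReal.ofReal D := by
  have hD0 : 0 ≤ D := by simpa using hD (fun _ => 0) (LipschitzWith.const' 0)
  let G : ℕ → SimpleFunc (EuclideanSpace ℝ (Fin d)) (EuclideanSpace ℝ (Fin d)) :=
    SimpleFunc.approxOn id measurable_id univ 0 (mem_univ 0)
  have happrox : ∀ m : Measure (EuclideanSpace ℝ (Fin d)), Integrable (fun z => z) m →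
      Filter.Tendsto (fun n => ∫⁻ z, edist z (G n z) ∂m) Filter.atTop (nhds 0) := by
    intro m hm
    have h := SimpleFunc.tendsto_approxOn_L1_enorm (μ := m) measurable_id
      (mem_univ (0 : EuclideanSpace ℝ (Fin d))) (.of_forall fun z => by simp) (by simpa using hm.2)
    refine h.congr fun n => lintegral_congr fun z => ?_
    rw [edist_comm, edist_eq_enorm_sub]; rfl
  refine ENNReal.le_of_forall_pos_le_add fun ε hε _ => ?_
  have hε4 : (0 : ℝ≥0∞) < ((ε / 4 : ℝ≥0) : ℝ≥0∞) := ENNReal.coe_pos.2 (by positivity)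
  obtain ⟨n, hnμ, hnν⟩ := (((happrox μ hμ).eventually_lt_const hε4).and
    ((happrox ν hν).eventually_lt_const hε4)).exists
  set g := G n
  have hdiff : ∀ m : Measure (EuclideanSpace ℝ (Fin d)), IsProbabilityMeasure m →
      Integrable (fun z => z) m → ∫⁻ z, edist z (g z) ∂m < ((ε / 4 : ℝ≥0) : ℝ≥0∞) →
      ∀ f : EuclideanSpace ℝ (Fin d) → ℝ, LipschitzWith 1 f →
        |∫ z, f z ∂m - ∫ z, f (g z) ∂m| ≤ ε / 4 := by
    intro m _ hm hlt f hf
    have hbase : Integrable (fun z => z - g z) m := by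
      refine ⟨(measurable_id.sub g.measurable).aestronglyMeasurable, ?_⟩
      rw [hasFiniteIntegral_iff_enorm]
      simp only [← edist_eq_enorm_sub]
      exact hlt.trans ENNReal.coe_lt_top
    have hfz : Integrable f m := by
      refine (hm.norm.add (integrable_const |f 0|)).mono' hf.continuous.aestronglyMeasurable
        (.of_forall fun z => ?_)
      have h := hf.dist_le_mul z 0
      rw [Real.dist_eq, NNReal.coe_one, one_mul, dist_zero_right] at h
      have h' := abs_sub_abs_le_abs_sub (f z) (f 0)
      simp only [Real.norm_eq_abs, Pi.add_apply]
      linarith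
    have hle : ∀ z, ‖f z - f (g z)‖ ≤ ‖z - g z‖ := fun z => by
      have h := hf.dist_le_mul z (g z)
      rwa [NNReal.coe_one, one_mul, dist_eq_norm, dist_eq_norm] at h
    have hsub : Integrable (fun z => f z - f (g z)) m :=
      hbase.norm.mono' (hf.continuous.measurable.sub
        (hf.continuous.measurable.comp g.measurable)).aestronglyMeasurable (.of_forall hle)
    have hfg : Integrable (fun z => f (g z)) m := by
      exact (hfz.sub hsub).congr (.of_forall fun z => sub_sub_cancel _ _)
    rw [← integral_sub hfz hfg, ← Real.norm_eq_abs]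
    refine (norm_integral_le_integral_norm _).trans
      ((integral_mono hsub.norm hbase.norm hle).trans ?_)
    rw [integral_norm_eq_lintegral_enorm hbase.aestronglyMeasurable]
    simp only [← edist_eq_enorm_sub]
    have h := ENNReal.toReal_mono ENNReal.coe_ne_top hlt.le
    simpa using h
  have hmid : wasserstein1 (μ.map g) (ν.map g) ≤ ENNReal.ofReal (D + ε / 2) := by
    refine wasserstein1_map_simpleFunc_le g fun f hf => ?_
    have h1 := (abs_le.1 (hdiff μ inferInstance hμ hnμ f hf)).1
    have h2 := (abs_le.1 (hdiff ν inferInstance hν hnν f hf)).2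
    linarith [hD f hf]
  have hpμ := Measure.isProbabilityMeasure_map (μ := μ) g.measurable.aemeasurable
  have hpν := Measure.isProbabilityMeasure_map (μ := ν) g.measurable.aemeasurable
  calc wasserstein1 μ ν ≤ wasserstein1 μ (μ.map g) + wasserstein1 (μ.map g) ν :=
        wasserstein1_triangle
    _ ≤ wasserstein1 μ (μ.map g) + (wasserstein1 (μ.map g) (ν.map g)
          + wasserstein1 (ν.map g) ν) := add_le_add_right wasserstein1_triangle _
    _ ≤ ((ε / 4 : ℝ≥0) : ℝ≥0∞) + (ENNReal.ofReal (D + ε / 2) + ((ε / 4 : ℝ≥0) : ℝ≥0∞)) := by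
        refine add_le_add ((wasserstein1_map_le g.measurable).trans hnμ.le)
          (add_le_add hmid ((wasserstein1_symm_le _ _).trans
            ((wasserstein1_map_le g.measurable).trans hnν.le)))
    _ = ENNReal.ofReal D + ε := by
        rw [← ENNReal.ofReal_coe_nnreal (p := ε / 4), ← ENNReal.ofReal_coe_nnreal (p := ε),
          ← ENNReal.ofReal_add (by positivity) (by positivity),
          ← ENNReal.ofReal_add (by positivity) (by positivity),
          ← ENNReal.ofReal_add (by positivity) (by positivity)]
        congr 1
        push_cast
        ring

end Duality

/-! ### Transport–entropy inequalities -/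

/-- Young's inequality for the conjugate pair `klFun`, `exp`. -/
lemma mul_le_klFun_add_exp {r : ℝ} (hr : 0 ≤ r) (g : ℝ) :
    r * g ≤ InformationTheory.klFun r - 1 + Real.exp g := by
  rw [InformationTheory.klFun]
  rcases hr.eq_or_lt with rfl | hr
  · simp [Real.exp_nonneg]
  · have h := mul_le_mul_of_nonneg_left (Real.add_one_le_exp (g - Real.log r)) hr.le
    rw [Real.exp_sub, Real.exp_log hr, mul_div_cancel₀ _ hr.ne'] at h
    linarith

section Entropy

variable {Z : Type*} [MeasurableSpace Z] {p q : Measure Z} [IsProbabilityMeasure p]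
  [IsProbabilityMeasure q]

lemma integrable_klFun_of_klDiv_ne_top (h : InformationTheory.klDiv q p ≠ ∞) :
    Integrable (fun z => InformationTheory.klFun (q.rnDeriv p z).toReal) p :=
  (InformationTheory.integrable_klFun_rnDeriv_iff (InformationTheory.klDiv_ne_top_iff.1 h).1).2
    (InformationTheory.klDiv_ne_top_iff.1 h).2

lemma integrable_of_klDiv_ne_top (h : InformationTheory.klDiv q p ≠ ∞) {f : Z → ℝ}
    (hf : Measurable f) (hexp : Integrable (fun z => Real.exp |f z|) p) : Integrable f q := by
  have hac := (InformationTheory.klDiv_ne_top_iff.1 h).1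
  rw [← integrable_rnDeriv_smul_iff hac]
  refine ((integrable_klFun_of_klDiv_ne_top h).add hexp).mono'
    ((Measure.measurable_rnDeriv _ _).ennreal_toReal.mul hf).aestronglyMeasurable
    (.of_forall fun z => ?_)
  rw [norm_smul, Real.norm_of_nonneg ENNReal.toReal_nonneg, Real.norm_eq_abs, Pi.add_apply]
  linarith [mul_le_klFun_add_exp (r := (q.rnDeriv p z).toReal) ENNReal.toReal_nonneg |f z|]

/-- The Gibbs variational inequality. -/
lemma integral_le_klDiv_add_log (h : InformationTheory.klDiv q p ≠ ∞) {g : Z → ℝ}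
    (hg : Integrable g q) (hexp : Integrable (fun z => Real.exp (g z)) p) :
    ∫ z, g z ∂q ≤ (InformationTheory.klDiv q p).toReal + Real.log (∫ z, Real.exp (g z) ∂p) := by
  have hac := (InformationTheory.klDiv_ne_top_iff.1 h).1
  have hkl := integrable_klFun_of_klDiv_ne_top h
  set c := Real.log (∫ z, Real.exp (g z) ∂p) with hc
  have hpos : 0 < ∫ z, Real.exp (g z) ∂p := integral_exp_pos hexp
  have hexp' : ∀ z, Real.exp (g z - c) = Real.exp (g z) / ∫ z, Real.exp (g z) ∂p := fun z => by
    rw [Real.exp_sub, hc, Real.exp_log hpos]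
  have hi : Integrable (fun z => Real.exp (g z - c)) p := by
    simp only [hexp']; exact hexp.div_const _
  have hgc : Integrable (fun z => g z - c) q := hg.sub (integrable_const c)
  have h1 : ∫ z, (g z - c) ∂q ≤ ∫ z, (InformationTheory.klFun (q.rnDeriv p z).toReal - 1
      + Real.exp (g z - c)) ∂p := by
    rw [← integral_rnDeriv_smul hac]
    exact integral_mono ((integrable_rnDeriv_smul_iff hac).2 hgc)
      ((hkl.sub (integrable_const 1)).add hi)
      fun z => mul_le_klFun_add_exp ENNReal.toReal_nonneg _
  have hkl1 : Integrable (fun z => InformationTheory.klFun (q.rnDeriv p z).toReal - 1) p :=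
    hkl.sub (integrable_const 1)
  rw [integral_sub hg (integrable_const c), integral_add hkl1 hi,
    integral_sub hkl (integrable_const 1), ← InformationTheory.toReal_klDiv_eq_integral_klFun hac]
    at h1
  simp only [hexp', integral_div, div_self hpos.ne', integral_const, probReal_univ, smul_eq_mul,
    one_mul] at h1
  linarith

end Entropy

section Transport

variable {d : ℕ} {p q ν₁ ν₂ : Measure (EuclideanSpace ℝ (Fin d))} {C : ℝ}

lemma SatisfiesLipschitzMGF.integrable [IsProbabilityMeasure p] [IsProbabilityMeasure q]
    (hp : SatisfiesLipschitzMGF p C) (h : InformationTheory.klDiv q p ≠ ∞)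
    {f : EuclideanSpace ℝ (Fin d) → ℝ} (hf : LipschitzWith 1 f) : Integrable f q := by
  set m := ∫ w, f w ∂p
  have hsub : Integrable (fun z => f z - m) q := by
    refine integrable_of_klDiv_ne_top h (hf.continuous.measurable.sub_const m) ?_
    have h1 := ((hp f hf).2 1).1
    have h2 := ((hp f hf).2 (-1)).1
    refine (h1.add h2).mono'
      (hf.continuous.measurable.sub_const m).abs.exp.aestronglyMeasurable
      (.of_forall fun z => ?_)
    rw [Real.norm_of_nonneg (Real.exp_nonneg _), Pi.add_apply, one_mul, neg_one_mul]
    rcases abs_choice (f z - m) with h' | h' <;> rw [h']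
    · exact le_add_of_nonneg_right (Real.exp_nonneg _)
    · exact le_add_of_nonneg_left (Real.exp_nonneg _)
  exact (hsub.add (integrable_const m)).congr (.of_forall fun z => sub_add_cancel _ _)

/-- The moment generating function bound controls `∫ f dq - ∫ f dp`: the Gibbs inequality gives
`t (∫ f dq - ∫ f dp) ≤ KL(q ‖ p) + C t² / 2`, and `t` is optimised. -/
lemma SatisfiesLipschitzMGF.integral_sub_le [IsProbabilityMeasure p] [IsProbabilityMeasure q]
    (hp : SatisfiesLipschitzMGF p C) (hC : 0 < C) (h : InformationTheory.klDiv q p ≠ ∞)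
    {f : EuclideanSpace ℝ (Fin d) → ℝ} (hf : LipschitzWith 1 f) :
    ∫ z, f z ∂q - ∫ z, f z ∂p ≤ √(2 * C * (InformationTheory.klDiv q p).toReal) := by
  have hfq := hp.integrable h hf
  set m := ∫ w, f w ∂p
  set D := ∫ z, f z ∂q - m with hD
  set K := (InformationTheory.klDiv q p).toReal
  have key : ∀ t : ℝ, t * D ≤ K + C * t ^ 2 / 2 := fun t => by
    obtain ⟨hexp, hlog⟩ := (hp f hf).2 t
    have hint : Integrable (fun z => t * (f z - m)) q := (hfq.sub (integrable_const m)).const_mul t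
    have h1 := integral_le_klDiv_add_log h hint hexp
    rw [integral_const_mul, integral_sub hfq (integrable_const m), integral_const,
      probReal_univ, one_smul] at h1
    linarith
  refine Real.le_sqrt_of_sq_le ?_
  -- `t = D / C` maximises `t D - C t² / 2`.
  have h1 := mul_le_mul_of_nonneg_left (key (D / C)) hC.le
  have e1 : C * (D / C * D) = D ^ 2 := by field_simp
  have e2 : C * (K + C * (D / C) ^ 2 / 2) = C * K + D ^ 2 / 2 := by field_simp
  rw [e1, e2] at h1
  linarith

lemma ofReal_mul_klDiv_rpow (hC : 0 < C) (h : InformationTheory.klDiv q p ≠ ∞) :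
    (ENNReal.ofReal (2 * C) * InformationTheory.klDiv q p) ^ (1 / 2 : ℝ)
      = ENNReal.ofReal √(2 * C * (InformationTheory.klDiv q p).toReal) := by
  rw [Real.sqrt_eq_rpow, ← ENNReal.ofReal_rpow_of_nonneg (by positivity) (by positivity),
    ENNReal.ofReal_mul (p := 2 * C) (by positivity), ENNReal.ofReal_toReal h]

lemma ofReal_mul_top_rpow (hC : 0 < C) :
    (ENNReal.ofReal (2 * C) * ∞) ^ (1 / 2 : ℝ) = ∞ := by
  rw [ENNReal.mul_top (by simpa using hC), ENNReal.top_rpow_of_pos (by positivity)]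

lemma SatisfiesT1.wasserstein1_le [IsProbabilityMeasure p] [IsProbabilityMeasure ν₁]
    [IsProbabilityMeasure ν₂] (hp : SatisfiesT1 p C) :
    wasserstein1 ν₁ ν₂ ≤ (ENNReal.ofReal (2 * C) * InformationTheory.klDiv ν₁ p) ^ (1 / 2 : ℝ)
      + (ENNReal.ofReal (2 * C) * InformationTheory.klDiv ν₂ p) ^ (1 / 2 : ℝ) :=
  (wasserstein1_triangle (ρ := p)).trans (add_le_add (hp ν₁ inferInstance)
    ((wasserstein1_symm_le _ _).trans (hp ν₂ inferInstance)))

lemma SatisfiesLipschitzMGF.wasserstein1_le [IsProbabilityMeasure p] [IsProbabilityMeasure ν₁]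
    [IsProbabilityMeasure ν₂] (hp : SatisfiesLipschitzMGF p C) (hC : 0 < C) :
    wasserstein1 ν₁ ν₂ ≤ (ENNReal.ofReal (2 * C) * InformationTheory.klDiv ν₁ p) ^ (1 / 2 : ℝ)
      + (ENNReal.ofReal (2 * C) * InformationTheory.klDiv ν₂ p) ^ (1 / 2 : ℝ) := by
  by_cases h₁ : InformationTheory.klDiv ν₁ p = ∞
  · rw [h₁, ofReal_mul_top_rpow hC, top_add]; exact le_top
  by_cases h₂ : InformationTheory.klDiv ν₂ p = ∞
  · rw [h₂, ofReal_mul_top_rpow hC, add_top]; exact le_top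
  rw [ofReal_mul_klDiv_rpow hC h₁, ofReal_mul_klDiv_rpow hC h₂,
    ← ENNReal.ofReal_add (Real.sqrt_nonneg _) (Real.sqrt_nonneg _)]
  have hid : ∀ q : Measure (EuclideanSpace ℝ (Fin d)), IsProbabilityMeasure q →
      InformationTheory.klDiv q p ≠ ∞ → Integrable (fun z => z) q := fun q _ hq =>
    (integrable_norm_iff measurable_id.aestronglyMeasurable).1
      (hp.integrable hq lipschitzWith_one_norm)
  refine wasserstein1_le_of_lipschitz (hid ν₁ inferInstance h₁) (hid ν₂ inferInstance h₂)
    fun f hf => ?_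
  have e1 := hp.integral_sub_le hC h₁ hf
  have e2 := hp.integral_sub_le hC h₂ hf.neg
  simp only [Pi.neg_apply, integral_neg] at e2
  linarith

end Transport

end

theorem mainTheorem2 {X : Type*} [MeasurableSpace X] {k d : ℕ}
    (F : ExpFamily X k) (hF : F.IsRegular) (x₁ x₂ : X)
    (hx₁ : 0 < F.h x₁) (hx₂ : 0 < F.h x₂)
    (hT₁ : F.T x₁ ∈ effectiveDomain (convexConjugate F.A))
    (hT₂ : F.T x₂ ∈ effectiveDomain (convexConjugate F.A))
    (p : Measure (EuclideanSpace ℝ (Fin d))) [IsProbabilityMeasure p]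
    (q₁ q₂ : EuclideanSpace ℝ (Fin d) → ℝ) (hq₁ : IsProbDensity q₁) (hq₂ : IsProbDensity q₂)
    (β : ℝ) (hβ : 0 ≤ β) :
    -- the value of the minimisation problem
    (Integrable (fun z => (q₁ z + q₂ z) *
        jensenGap (convexConjugate F.A) (F.T x₁) (F.T x₂) (posteriorRatio q₁ q₂ z)) ∧
      IsGLB (twoUserObjective F x₁ x₂ p q₁ q₂ β '' admissibleMaps F d)
        (((-(Real.log (F.h x₁) + (convexConjugate F.A (F.T x₁)).toReal
            + (Real.log (F.h x₂) + (convexConjugate F.A (F.T x₂)).toReal))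
          + ∫ z, (q₁ z + q₂ z) * jensenGap (convexConjugate F.A) (F.T x₁) (F.T x₂)
              (posteriorRatio q₁ q₂ z) : ℝ) : EReal)
          + klTerm p q₁ q₂ β)) ∧
    -- the infimum is attained when the mixed statistics are interior
    ((∀ᵐ z, 0 < q₁ z + q₂ z →
        posteriorRatio q₁ q₂ z • F.T x₁ + (1 - posteriorRatio q₁ q₂ z) • F.T x₂
          ∈ interior (effectiveDomain (convexConjugate F.A))) →
      IsLeast (twoUserObjective F x₁ x₂ p q₁ q₂ β '' admissibleMaps F d)
        (((-(Real.log (F.h x₁) + (convexConjugate F.A (F.T x₁)).toReal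
            + (Real.log (F.h x₂) + (convexConjugate F.A (F.T x₂)).toReal))
          + ∫ z, (q₁ z + q₂ z) * jensenGap (convexConjugate F.A) (F.T x₁) (F.T x₂)
              (posteriorRatio q₁ q₂ z) : ℝ) : EReal)
          + klTerm p q₁ q₂ β)) ∧
    -- the gap is nonnegative
    (∀ a ∈ Icc (0 : ℝ) 1, 0 ≤ jensenGap (convexConjugate F.A) (F.T x₁) (F.T x₂) a) ∧
    -- the equality case
    (((∀ᵐ z, q₁ z * q₂ z = 0) ∨ F.T x₁ = F.T x₂) →
      ∫ z, (q₁ z + q₂ z) * jensenGap (convexConjugate F.A) (F.T x₁) (F.T x₂)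
        (posteriorRatio q₁ q₂ z) = 0) ∧
    ((F.naturalSpace = univ ∨ ∃ a ∈ Ioo (0 : ℝ) 1,
        a • F.T x₁ + (1 - a) • F.T x₂ ∈ interior (effectiveDomain (convexConjugate F.A))) →
      (∀ a ∈ Icc (0 : ℝ) 1,
        (jensenGap (convexConjugate F.A) (F.T x₁) (F.T x₂) a = 0 ↔
          a = 0 ∨ a = 1 ∨ F.T x₁ = F.T x₂)) ∧
      (∫ z, (q₁ z + q₂ z) * jensenGap (convexConjugate F.A) (F.T x₁) (F.T x₂)
          (posteriorRatio q₁ q₂ z) = 0 ↔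
        (∀ᵐ z, q₁ z * q₂ z = 0) ∨ F.T x₁ = F.T x₂)) ∧
    -- the transport bound
    (∀ C : ℝ, 0 < C → (SatisfiesT1 p C ∨ SatisfiesLipschitzMGF p C) →
      wasserstein1 (densityMeasure q₁) (densityMeasure q₂) ≤
        (ENNReal.ofReal (2 * C) * InformationTheory.klDiv (densityMeasure q₁) p) ^ (1 / 2 : ℝ)
        + (ENNReal.ofReal (2 * C) * InformationTheory.klDiv (densityMeasure q₂) p) ^ (1 / 2 : ℝ))
    := by
  have h := ExpFamily.integrable_weightedGap hF hT₁ hT₂ hq₁ hq₂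
  have hP₁ := hq₁.isProbabilityMeasure
  have hP₂ := hq₂.isProbabilityMeasure
  exact ⟨⟨h, ExpFamily.isGLB_twoUserObjective hF hx₁ hx₂ hT₁ hT₂ p hq₁ hq₂ β⟩,
    ExpFamily.isLeast_twoUserObjective hF hx₁ hx₂ hT₁ hT₂ p hq₁ hq₂ β,
    fun a ha => ExpFamily.jensenGap_nonneg hF hT₁ hT₂ ha,
    ExpFamily.integral_weightedGap_eq_zero hq₁ hq₂,
    fun hN => ⟨fun a ha => ExpFamily.jensenGap_eq_zero_iff hF hT₁ hT₂ hN ha,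
      ExpFamily.integral_weightedGap_eq_zero_iff hF hT₁ hT₂ hq₁ hq₂ hN⟩,
    fun C hC hp => hp.elim (fun hp => hp.wasserstein1_le) fun hp => hp.wasserstein1_le hC⟩
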